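/- Let $\|\cdot\|$ be the Frobenius norm. Consider floating point arithmetic obeying the standard model: $\mathbb F\subset\mathbb R$ is the set of floating point numbers, $\mathrm{fl}:\mathbb R\to\mathbb F$ is the rounding map, with $\mathrm{fl}(x)=x$ for $x\in\mathbb F$ and $|\mathrm{fl}(x)-x|\le \mathbf u|x|$ for all $x$, where $\mathbf u>0$ is the unit roundoff, and every scalar operation $x\,\mathrm{op}\,y$ is computed as $\mathrm{fl}(x\,\mathrm{op}\,y)$. Put $\gamma_j:=\dfrac{j\mathbf u}{1-j\mathbf u}$. **Theorem.** There is an integer constant $c>1$ such that the following holds. Let $1\le s\le n$, let $A\in\mathbb R^{n\times n}$ be nonsingular with at most $m$ nonzero entries per row ($m$ being the maximum over the rows), let $B\in\mathbb F^{n\times s}$, and let $k\ge 1$. Consider one of two methods of QR decomposition, Givens rotations (applied in any standard order, in at most $n+s-2$ stages of rotations acting on disjoint pairs of rows) or Householder transformations, the Q-factor being formed by applying the transposed transformations in reverse order to the first $s$ columns of the identity. Assume $(m+3s)\mathbf u<1$ and $$ \begin{cases} c\left[(n+2(s-1))(\sqrt s+1)+1\right]\mathbf u<\tfrac12 & \text{for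 Givens},\\[2pt] c\left[(n+1)(\sqrt s+1)s+1\right]\mathbf u<\tfrac12 & \text{for Householder}. \end{cases} $$ (a) Let $P_{i-1}\in\mathbb R^{n\times s}$ and $\alpha_{i-1}\in\mathbb R^{s\times s}$ $(1\le i\le k)$ be arbitrary, and let $\widehat Q_{i-1}\in\mathbb R^{n\times s}$ be the Q-factor of $P_{i-1}$ computed in floating point arithmetic by the chosen method. Let $X_0=O$, $R_0=B-AX_0=B$, and let $X_i,R_i\in\mathbb F^{n\times s}$ be computed in floating point arithmetic by $$X_i=X_{i-1}+\widehat Q_{i-1}\alpha_{i-1},\qquad R_i=R_{i-1}-(A\widehat Q_{i-1})\alpha_{i-1}\qquad(1\le i\le k),$$ that is, $X_i=\mathrm{fl}(X_{i-1}+\mathrm{fl}(\widehat Q_{i-1}\alpha_{i-1}))$ and $R_i=\mathrm{fl}(R_{i-1}-\mathrm{fl}(\mathrm{fl}(A\widehat Q_{i-1})\alpha_{i-1}))$, where the sums in the matrix products are evaluated in any order and only the nonzero entries of $A$ are used in $A\widehat Q_{i-1}$. If $X_1,\dots,X_k,R_1,\dots,R_k$ are not all zero, then the residual gap $G_{R_k}:=(B-AX_k)-R_k$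 satisfies $$ \|G_{R_k}\|<\left(8\sqrt s\,\gamma_{m+3s}+\gamma_1\right)k\,\|A\|\max_{0<i\le k}\|X_i\|+k\,\gamma_1\max_{0<i\le k}\|R_i\| . $$ (b) Consider $k$ steps of block cross-interactive residual smoothing (Bl-CIRS) with orthonormalization in floating point arithmetic: with $X_0=Y_0=O$, $R_0=S_0=B$, $\tilde Q_0=O$, $\tilde\xi_0=\tilde\eta_0=O$, and directions $\tilde P_i\in\mathbb R^{n\times s}$ supplied by an arbitrary primary method, for $0\le i<k$ one computes $$V_{i+1}=\tilde Q_i(\tilde\xi_i-\tilde\eta_i)+\tilde P_i,\qquad [\tilde Q_{i+1},\tilde\xi_{i+1}]=\mathbf{qr}(V_{i+1}),\qquad \tilde U_{i+1}=A\tilde Q_{i+1},$$ $$Y_{i+1}=Y_i+\tilde Q_{i+1}\tilde\eta_{i+1},\qquad S_{i+1}=S_i-\tilde U_{i+1}\tilde\eta_{i+1},$$ $$X_{i+1}=Y_{i+1}+\tilde Q_{i+1}(\tilde\xi_{i+1}-\tilde\eta_{i+1}),\qquad R_{i+1}=S_{i+1}-\tilde U_{i+1}(\tilde\xi_{i+1}-\tilde\eta_{i+1}),$$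 where $\mathbf{qr}$ is the computed QR decomposition by the chosen method and $\tilde\eta_{i+1}\in\mathbb R^{s\times s}$ is the computed smoothing parameter, on whose accuracy nothing is assumed. If $Y_1,\dots,Y_k,S_1,\dots,S_k$ are not all zero, then $G_{S_k}:=(B-AY_k)-S_k$ satisfies $$ \|G_{S_k}\|<\left(8\sqrt s\,\gamma_{m+3s}+\gamma_1\right)k\,\|A\|\max_{0<i\le k}\|Y_i\|+k\,\gamma_1\max_{0<i\le k}\|S_i\| . $$ -/

import Mathlib

/- The norm of a real matrix is the Frobenius norm throughout. -/
attribute [local instance] Matrix.frobeniusNormedAddCommGroup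

noncomputable section

namespace BlockResidual

/-! ### Floating point arithmetic -/

/-- The standard model of floating point arithmetic (no overflow, no underflow): a set `F` of
floating point numbers, a rounding map `fl` onto `F`, and the unit roundoff `u`. The computed value
of a scalar operation `x op y` is `fl (x op y)`, so that
`fl (x op y) = (x op y) (1 + δ)` with `|δ| ≤ u`. -/
structure FloatArith where
  F : Set ℝ
  fl : ℝ → ℝ
  u : ℝ
  u_pos : 0 < u
  fl_mem : ∀ x, fl x ∈ F
  fl_of_mem : ∀ x ∈ F, fl x = x
  abs_fl_sub_le : ∀ x, |fl x - x| ≤ u * |x|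

/-- `γ_k = k u / (1 - k u)`. -/
def FloatArith.gamma (fp : FloatArith) (k : ℕ) : ℝ := k * fp.u / (1 - k * fp.u)

/-- `IsFlSum fp t r`: `r` is obtained by adding up the (nonempty) family `t` of numbers in floating
point arithmetic, in some order and with some bracketing. -/
inductive IsFlSum (fp : FloatArith) : Multiset ℝ → ℝ → Prop
  | single (x : ℝ) : IsFlSum fp {x} x
  | add {t t' : Multiset ℝ} {a b : ℝ} :
      IsFlSum fp t a → IsFlSum fp t' b → IsFlSum fp (t + t') (fp.fl (a + b))

/-- `r` is a computed value of the inner product `∑ i ∈ t, x i * y i`, in some order of summation. -/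
def IsFlDot (fp : FloatArith) {ι : Type} (t : Finset ι) (x y : ι → ℝ) (r : ℝ) : Prop :=
  (t = ∅ ∧ r = 0) ∨ IsFlSum fp (t.val.map fun i => fp.fl (x i * y i)) r

/-- The computed sum of two matrices. -/
def flAdd (fp : FloatArith) {a b : ℕ} (M N : Matrix (Fin a) (Fin b) ℝ) :
    Matrix (Fin a) (Fin b) ℝ := Matrix.of fun i j => fp.fl (M i j + N i j)

/-- The computed difference of two matrices. -/
def flSub (fp : FloatArith) {a b : ℕ} (M N : Matrix (Fin a) (Fin b) ℝ) :
    Matrix (Fin a) (Fin b) ℝ := Matrix.of fun i j => fp.fl (M i j - N i j)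

/-- `W` is a computed value of the (dense) matrix product `M * N`. -/
def IsFlMul (fp : FloatArith) {a b d : ℕ} (M : Matrix (Fin a) (Fin b) ℝ)
    (N : Matrix (Fin b) (Fin d) ℝ) (W : Matrix (Fin a) (Fin d) ℝ) : Prop :=
  ∀ i j, IsFlDot fp Finset.univ (fun l => M i l) (fun l => N l j) (W i j)

/-- The column indices of the nonzero entries in the `i`th row of `A`. -/
def rowSupport {n : ℕ} (A : Matrix (Fin n) (Fin n) ℝ) (i : Fin n) : Finset (Fin n) :=
  open Classical in Finset.univ.filter fun l => A i l ≠ 0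

/-- The maximum number of nonzero entries per row of `A`. -/
def maxRowNnz {n : ℕ} (A : Matrix (Fin n) (Fin n) ℝ) : ℕ :=
  Finset.univ.sup fun i => (rowSupport A i).card

/-- `W` is a computed value of `A * N` for a sparse matrix `A`: only the nonzero entries of `A`
take part. (Terms with a zero entry would not change the computed values anyway, since `fl 0 = 0`
and `fl` fixes floating point numbers.) -/
def IsFlSparseMul (fp : FloatArith) {n s : ℕ} (A : Matrix (Fin n) (Fin n) ℝ)
    (N W : Matrix (Fin n) (Fin s) ℝ) : Prop :=
  ∀ i j, IsFlDot fp (rowSupport A i) (fun l => A i l) (fun l => N l j) (W i j)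

/-- The first `s` columns of the identity matrix of order `n`. -/
def idCols {n s : ℕ} (hsn : s ≤ n) : Matrix (Fin n) (Fin s) ℝ :=
  Matrix.of fun i j => if i = Fin.castLE hsn j then 1 else 0

/-! ### Householder QR decomposition in floating point arithmetic -/

/-- `v`, `β` is a computed Householder vector for `x(k:n)`: with the computed Euclidean norm `σ` of
`x(k:n)`, one takes `v = x(k:n)` with `v_k = x_k + sign(x_k) σ`, and `β = 1 / (σ |v_k|)`
(`= 2 / vᵀv` in exact arithmetic). The transformation is `I - β v vᵀ`, and the identity if
`x(k:n) = 0`. -/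
def IsFlHouseholderVector (fp : FloatArith) {n : ℕ} (k : Fin n) (x v : Fin n → ℝ) (β : ℝ) : Prop :=
  ∃ t σ : ℝ, IsFlDot fp (Finset.Ici k) x x t ∧ σ = fp.fl (Real.sqrt t) ∧
    ((σ = 0 ∧ v = 0 ∧ β = 0) ∨
     (σ ≠ 0 ∧
      (∀ i, i < k → v i = 0) ∧
      v k = (if 0 ≤ x k then fp.fl (x k + σ) else fp.fl (x k - σ)) ∧
      (∀ i, k < i → v i = x i) ∧
      β = fp.fl (1 / fp.fl (σ * |v k|))))

/-- `y` is a computed value of `(I - β v vᵀ) x = x - v (β (vᵀ x))`, where `v` is supported on the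
indices `≥ k`. -/
def IsFlReflected (fp : FloatArith) {n : ℕ} (k : Fin n) (v : Fin n → ℝ) (β : ℝ)
    (x y : Fin n → ℝ) : Prop :=
  ∃ w : ℝ, IsFlDot fp (Finset.Ici k) v x w ∧
    (∀ i, i < k → y i = x i) ∧
    (∀ i, k ≤ i → y i = fp.fl (x i - fp.fl (v i * fp.fl (β * w))))

/-- `Qhat` (`n × s`) and `Rhat` (`s × s`) are the thin Q-factor and the R-factor of `P` computed by
Householder QR. `M k` is the array after `k` transformations, which overwrite `P`; the Q-factor is
formed by applying the transformations in reverse order to the first columns of the identity, `N k`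
being the array when the transformations `s-1, …, k` have been applied. -/
def IsFlHouseholderQR (fp : FloatArith) {n s : ℕ} (hsn : s ≤ n)
    (P Qhat : Matrix (Fin n) (Fin s) ℝ) (Rhat : Matrix (Fin s) (Fin s) ℝ) : Prop :=
  ∃ (v : Fin s → Fin n → ℝ) (β : Fin s → ℝ) (M N : ℕ → Matrix (Fin n) (Fin s) ℝ),
    M 0 = P ∧
    (∀ k : Fin s,
      IsFlHouseholderVector fp (Fin.castLE hsn k) (fun i => M k i k) (v k) (β k) ∧
      (∀ j, j < k → ∀ i, M (k + 1) i j = M k i j) ∧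
      (∃ y, IsFlReflected fp (Fin.castLE hsn k) (v k) (β k) (fun i => M k i k) y ∧
        ∀ i, M (k + 1) i k = if Fin.castLE hsn k < i then 0 else y i) ∧
      (∀ j, k < j → IsFlReflected fp (Fin.castLE hsn k) (v k) (β k)
        (fun i => M k i j) (fun i => M (k + 1) i j))) ∧
    N s = idCols hsn ∧
    (∀ k j : Fin s, IsFlReflected fp (Fin.castLE hsn k) (v k) (β k)
      (fun i => N (k + 1) i j) (fun i => N k i j)) ∧
    Qhat = N 0 ∧
    Rhat = Matrix.of fun i j => if i ≤ j then M s (Fin.castLE hsn i) j else 0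

/-! ### Givens QR decomposition in floating point arithmetic -/

/-- One Givens rotation: it acts on the rows `p` and `q` and annihilates the entry `(q, j)`. -/
structure GivensStep (n s : ℕ) where
  p : Fin n
  q : Fin n
  j : Fin s

/-- The entry `(q, j)` is annihilated by one of the rotations in `L`. -/
def Annihilated {n s : ℕ} (L : List (GivensStep n s)) (q : Fin n) (j : Fin s) : Prop :=
  ∃ e ∈ L, e.q = q ∧ e.j = j

/-- `L` is an admissible order of the rotations in Givens QR for `n × s` matrices, listed as
stages of rotations that act on pairwise disjoint pairs of rows; as in all the standard orders,
there are at most `n + s - 2` stages. Each rotation annihilates a new entry below the diagonal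
without destroying a zero created before, and in the end all of these entries are annihilated. -/
structure IsGivensSchedule {n s : ℕ} (L : List (List (GivensStep n s))) : Prop where
  length_le : L.length + 2 ≤ n + s
  disjoint : ∀ σ ∈ L, σ.Pairwise fun e f =>
    e.p ≠ f.p ∧ e.p ≠ f.q ∧ e.q ≠ f.p ∧ e.q ≠ f.q
  valid : ∀ pre e post, L.flatten = pre ++ e :: post →
    e.p ≠ e.q ∧ (e.j : ℕ) < (e.q : ℕ) ∧
    (∀ l, l < e.j → Annihilated pre e.p l ∧ Annihilated pre e.q l) ∧
    ¬ Annihilated pre e.p e.j ∧ ¬ Annihilated pre e.q e.j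
  complete : ∀ (q : Fin n) (j : Fin s), (j : ℕ) < (q : ℕ) → Annihilated L.flatten q j

/-- The computed cosine and sine `a / √(a² + b²)`, `b / √(a² + b²)` of the rotation that maps
`(a, b)` to `(√(a² + b²), 0)`; no rotation if `b = 0`. -/
def givensCS (fp : FloatArith) (a b : ℝ) : ℝ × ℝ :=
  open Classical in
  if b = 0 then (1, 0)
  else
    (fp.fl (a / fp.fl (Real.sqrt (fp.fl (fp.fl (a * a) + fp.fl (b * b))))),
     fp.fl (b / fp.fl (Real.sqrt (fp.fl (fp.fl (a * a) + fp.fl (b * b))))))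

/-- The cosine and sine computed for the rotation `e` from the current array `M`. -/
def stepCS (fp : FloatArith) {n s : ℕ} (e : GivensStep n s) (M : Matrix (Fin n) (Fin s) ℝ) :
    ℝ × ℝ := givensCS fp (M e.p e.j) (M e.q e.j)

/-- The rotation `e` applied to the array `M`; the annihilated entry is set to zero. -/
def givensForward (fp : FloatArith) {n s : ℕ} (e : GivensStep n s)
    (M : Matrix (Fin n) (Fin s) ℝ) : Matrix (Fin n) (Fin s) ℝ :=
  Matrix.of fun i l =>
    if i = e.p then
      fp.fl (fp.fl ((stepCS fp e M).1 * M e.p l) + fp.fl ((stepCS fp e M).2 * M e.q l))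
    else if i = e.q then
      (if l = e.j then 0
       else fp.fl (fp.fl ((stepCS fp e M).1 * M e.q l) - fp.fl ((stepCS fp e M).2 * M e.p l)))
    else M i l

/-- The transposed rotation with cosine and sine `cs`, in the rows `p` and `q`, applied to `N`. -/
def givensTransposed (fp : FloatArith) {n s : ℕ} (p q : Fin n) (cs : ℝ × ℝ)
    (N : Matrix (Fin n) (Fin s) ℝ) : Matrix (Fin n) (Fin s) ℝ :=
  Matrix.of fun i l =>
    if i = p then fp.fl (fp.fl (cs.1 * N p l) - fp.fl (cs.2 * N q l))
    else if i = q then fp.fl (fp.fl (cs.2 * N p l) + fp.fl (cs.1 * N q l))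
    else N i l

/-- The array left by the rotations in the list. -/
def givensReduce (fp : FloatArith) {n s : ℕ} :
    List (GivensStep n s) → Matrix (Fin n) (Fin s) ℝ → Matrix (Fin n) (Fin s) ℝ
  | [], M => M
  | e :: L, M => givensReduce fp L (givensForward fp e M)

/-- The first `s` columns of the Q-factor `G₁ᵀ G₂ᵀ ⋯ G_Nᵀ`, computed by applying the transposed
rotations in reverse order to the first columns of the identity. -/
def givensQ (fp : FloatArith) {n s : ℕ} (hsn : s ≤ n) :
    List (GivensStep n s) → Matrix (Fin n) (Fin s) ℝ → Matrix (Fin n) (Fin s) ℝ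
  | [], _ => idCols hsn
  | e :: L, M =>
      givensTransposed fp e.p e.q (stepCS fp e M) (givensQ fp hsn L (givensForward fp e M))

/-- `Qhat` (`n × s`) and `Rhat` (`s × s`) are the thin Q-factor and the R-factor of `P` computed by
Givens QR. -/
def IsFlGivensQR (fp : FloatArith) {n s : ℕ} (hsn : s ≤ n)
    (P Qhat : Matrix (Fin n) (Fin s) ℝ) (Rhat : Matrix (Fin s) (Fin s) ℝ) : Prop :=
  ∃ L : List (List (GivensStep n s)), IsGivensSchedule L ∧
    Qhat = givensQ fp hsn L.flatten P ∧
    Rhat = Matrix.of fun i j =>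
      if i ≤ j then givensReduce fp L.flatten P (Fin.castLE hsn i) j else 0

/-! ### The two methods together -/

inductive QRMethod
  | givens
  | householder

/-- `Qhat` and `Rhat` are the factors of `P` computed by the given method. -/
def IsFlQR (fp : FloatArith) (method : QRMethod) {n s : ℕ} (hsn : s ≤ n)
    (P Qhat : Matrix (Fin n) (Fin s) ℝ) (Rhat : Matrix (Fin s) (Fin s) ℝ) : Prop :=
  match method with
  | .givens => IsFlGivensQR fp hsn P Qhat Rhat
  | .householder => IsFlHouseholderQR fp hsn P Qhat Rhat

/-- The factor in the smallness condition `c * sizeFactor * u < 1 / 2`. -/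
def sizeFactor (method : QRMethod) (n s : ℕ) : ℝ :=
  match method with
  | .givens => ((n : ℝ) + 2 * ((s : ℝ) - 1)) * (Real.sqrt s + 1) + 1
  | .householder => ((n : ℝ) + 1) * (Real.sqrt s + 1) * s + 1

/-! ### Recursions -/

/-- `X' = fl(X + fl(Q α))`. -/
def IsFlUpdateX (fp : FloatArith) {n s : ℕ} (X Q : Matrix (Fin n) (Fin s) ℝ)
    (α : Matrix (Fin s) (Fin s) ℝ) (X' : Matrix (Fin n) (Fin s) ℝ) : Prop :=
  ∃ T, IsFlMul fp Q α T ∧ X' = flAdd fp X T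

/-- `R' = fl(R - fl(U α))`. -/
def IsFlUpdateR (fp : FloatArith) {n s : ℕ} (R U : Matrix (Fin n) (Fin s) ℝ)
    (α : Matrix (Fin s) (Fin s) ℝ) (R' : Matrix (Fin n) (Fin s) ℝ) : Prop :=
  ∃ T, IsFlMul fp U α T ∧ R' = flSub fp R T

/-- The first `K` steps of the recursions `X_k = X_{k-1} + Q̂_{k-1} α_{k-1}`,
`R_k = R_{k-1} - (A Q̂_{k-1}) α_{k-1}` in floating point arithmetic, with `X_0 = O` and
`R_0 = B - A X_0 = B`, where `Q̂_i` is the Q-factor of `P_i` computed by the given method. The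
matrices `P_i` and `α_i` are arbitrary. -/
structure IsFlRecursion (fp : FloatArith) (method : QRMethod) {n s : ℕ} (hsn : s ≤ n)
    (A : Matrix (Fin n) (Fin n) ℝ) (B : Matrix (Fin n) (Fin s) ℝ)
    (P Qhat : ℕ → Matrix (Fin n) (Fin s) ℝ) (α : ℕ → Matrix (Fin s) (Fin s) ℝ)
    (X R : ℕ → Matrix (Fin n) (Fin s) ℝ) (K : ℕ) : Prop where
  X_zero : X 0 = 0
  R_zero : R 0 = B
  qr : ∀ k < K, ∃ Rhat, IsFlQR fp method hsn (P k) (Qhat k) Rhat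
  X_succ : ∀ k < K, IsFlUpdateX fp (X k) (Qhat k) (α k) (X (k + 1))
  R_succ : ∀ k < K, ∃ U, IsFlSparseMul fp A (Qhat k) U ∧
    IsFlUpdateR fp (R k) U (α k) (R (k + 1))

/-- The matrices that occur in Bl-CIRS with orthonormalization. -/
structure BlCIRSData (n s : ℕ) where
  P : ℕ → Matrix (Fin n) (Fin s) ℝ
  V : ℕ → Matrix (Fin n) (Fin s) ℝ
  Q : ℕ → Matrix (Fin n) (Fin s) ℝ
  U : ℕ → Matrix (Fin n) (Fin s) ℝ
  Y : ℕ → Matrix (Fin n) (Fin s) ℝ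
  S : ℕ → Matrix (Fin n) (Fin s) ℝ
  X : ℕ → Matrix (Fin n) (Fin s) ℝ
  R : ℕ → Matrix (Fin n) (Fin s) ℝ
  ξ : ℕ → Matrix (Fin s) (Fin s) ℝ
  η : ℕ → Matrix (Fin s) (Fin s) ℝ

/-- The first `K` steps of Bl-CIRS with orthonormalization, in floating point arithmetic, with the
initial guess `X_0 = O` and the initial residual `R_0 = B`. The direction `P k` comes from the
primary method, which is not specified. The smoothing parameter `η (k + 1)`, in exact arithmetic
the minimizer of `‖S_k - U_{k+1} η‖`, is whatever has been computed for it: nothing is asked of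
its accuracy. -/
structure IsFlBlCIRS (fp : FloatArith) (method : QRMethod) {n s : ℕ} (hsn : s ≤ n)
    (A : Matrix (Fin n) (Fin n) ℝ) (B : Matrix (Fin n) (Fin s) ℝ)
    (D : BlCIRSData n s) (K : ℕ) : Prop where
  X_zero : D.X 0 = 0
  R_zero : D.R 0 = B
  Y_zero : D.Y 0 = D.X 0
  S_zero : D.S 0 = D.R 0
  Q_zero : D.Q 0 = 0
  ξ_zero : D.ξ 0 = 0
  η_zero : D.η 0 = 0
  V_succ : ∀ k < K, ∃ T, IsFlMul fp (D.Q k) (flSub fp (D.ξ k) (D.η k)) T ∧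
    D.V (k + 1) = flAdd fp T (D.P k)
  qr : ∀ k < K, IsFlQR fp method hsn (D.V (k + 1)) (D.Q (k + 1)) (D.ξ (k + 1))
  U_succ : ∀ k < K, IsFlSparseMul fp A (D.Q (k + 1)) (D.U (k + 1))
  Y_succ : ∀ k < K, IsFlUpdateX fp (D.Y k) (D.Q (k + 1)) (D.η (k + 1)) (D.Y (k + 1))
  S_succ : ∀ k < K, IsFlUpdateR fp (D.S k) (D.U (k + 1)) (D.η (k + 1)) (D.S (k + 1))
  X_succ : ∀ k < K, IsFlUpdateX fp (D.Y (k + 1)) (D.Q (k + 1))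
    (flSub fp (D.ξ (k + 1)) (D.η (k + 1))) (D.X (k + 1))
  R_succ : ∀ k < K, IsFlUpdateR fp (D.S (k + 1)) (D.U (k + 1))
    (flSub fp (D.ξ (k + 1)) (D.η (k + 1))) (D.R (k + 1))

/-! ### Residual gap -/

/-- `G = (B - A X) - R`, in exact arithmetic. -/
def residualGap {n s : ℕ} (A : Matrix (Fin n) (Fin n) ℝ) (B X R : Matrix (Fin n) (Fin s) ℝ) :
    Matrix (Fin n) (Fin s) ℝ := (B - A * X) - R

/-- `max_{0 < i ≤ k} ‖Z i‖`. -/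
def maxNorm {n s : ℕ} (Z : ℕ → Matrix (Fin n) (Fin s) ℝ) (k : ℕ) (hk : 1 ≤ k) : ℝ :=
  (Finset.Icc 1 k).sup' (Finset.nonempty_Icc.mpr hk) fun i => ‖Z i‖

end BlockResidual

end

/-! One step changes the gap by `(W - A * T) - A * δX - δR`, where `T` and `W` are the computed
products `Q̂α` and `(AQ̂)α`, and `δX`, `δR` are the rounding errors of the final addition and
subtraction. The last two errors are measured against the rounded results, which gives the `γ₁`
terms. The difference `W - A * T` consists of rounding errors of matrix products only, so it is at
most `γ_{m+3s} ‖A‖ ‖Q̂‖ ‖α‖`. What remains is to bound `‖α‖`, about which nothing is assumed.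

This is where orthonormality enters. Backward stability of Givens and Householder QR puts `Q̂`
within `1/8` of a matrix with exactly orthonormal columns, whatever matrix is factored
(`IsFlQR.exists_norm_sub_le`). Multiplication by `Q̂` therefore nearly preserves the norm, and `α`
is controlled by `T`, hence by the iterates: `T` is `X_i - X_{i-1}` up to rounding, so `‖α‖ ≤ 4 max
‖X_i‖` (`norm_residualGap_sub_le`). With `‖Q̂‖ ≤ (9/8)√s` each step contributes `(9/2)√s γ_{m+3s}`,
and the slack between `9/2` and `8` gives the strict inequality after summation over `k` steps.

For the nearness of `Q̂`, each reflection or each stage of disjoint rotations is compared with an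
exactly orthogonal map, which carries orthonormal columns to orthonormal columns; the relative
errors then compound as `(1 + ε) ^ r - 1` (`NearOrthonormal.step`). -/

namespace BlockResidual

/-! ### Rounding errors of sums and inner products -/

/-- The accumulated relative error `(1 + u) ^ k - 1` of `k` roundings. -/
def FloatArith.nu (fp : FloatArith) (k : ℕ) : ℝ := (1 + fp.u) ^ k - 1

namespace FloatArith

variable (fp : FloatArith)

theorem nu_nonneg (k : ℕ) : 0 ≤ fp.nu k :=
  sub_nonneg.mpr (one_le_pow₀ (by linarith [fp.u_pos]))

theorem nu_mono {j k : ℕ} (h : j ≤ k) : fp.nu j ≤ fp.nu k :=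
  sub_le_sub_right (pow_le_pow_right₀ (by linarith [fp.u_pos]) h) 1

theorem nu_zero : fp.nu 0 = 0 := by simp [nu]

theorem nu_succ (k : ℕ) : fp.nu (k + 1) = fp.u * (1 + fp.nu k) + fp.nu k := by
  simp only [nu, pow_succ]; ring

theorem nu_add (j k : ℕ) : fp.nu (j + k) = fp.nu j + fp.nu k + fp.nu j * fp.nu k := by
  simp only [nu, pow_add]; ring

theorem nu_add_le (j k : ℕ) : fp.nu j + fp.nu k ≤ fp.nu (j + k) := by
  rw [nu_add]; nlinarith [fp.nu_nonneg j, fp.nu_nonneg k]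

end FloatArith

/-- Bernoulli gives `1 - kx ≤ (1 - x)^k`, and `(1 + x)^k (1 - x)^k ≤ 1`. The bound serves twice:
with `x = u` for roundings and with `x = ε` for transformations. -/
theorem one_add_pow_sub_one_le {x : ℝ} (hx : 0 ≤ x) (k : ℕ) (h : k * x < 1) :
    (1 + x) ^ k - 1 ≤ k * x / (1 - k * x) := by
  rw [le_div_iff₀ (by linarith)]
  rcases Nat.eq_zero_or_pos k with rfl | hk
  · simp
  have hk1 : (1 : ℝ) ≤ k := by exact_mod_cast hk
  have hx1 : x ≤ 1 := by nlinarith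
  have h1 : 1 - k * x ≤ (1 - x) ^ k := by
    have := one_add_mul_le_pow (a := -x) (by linarith) k
    rw [← sub_eq_add_neg] at this
    linarith
  have h2 : (1 + x) ^ k * (1 - x) ^ k ≤ 1 := by
    rw [← mul_pow]
    exact pow_le_one₀ (by nlinarith) (by nlinarith)
  nlinarith [pow_pos (by linarith : (0 : ℝ) < 1 + x) k]

theorem one_add_pow_sub_one_le_two_mul {x : ℝ} (hx : 0 ≤ x) (k : ℕ) (h : k * x ≤ 1 / 2) :
    (1 + x) ^ k - 1 ≤ 2 * (k * x) := by
  refine (one_add_pow_sub_one_le hx k (by linarith)).trans ?_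
  rw [div_le_iff₀ (by linarith)]
  nlinarith [mul_nonneg (Nat.cast_nonneg (α := ℝ) k) hx]

namespace FloatArith

variable (fp : FloatArith)

theorem nu_le_gamma {k : ℕ} (h : k * fp.u < 1) : fp.nu k ≤ fp.gamma k :=
  one_add_pow_sub_one_le fp.u_pos.le k h

theorem nu_le_two_mul {k : ℕ} (h : k * fp.u ≤ 1 / 2) : fp.nu k ≤ 2 * (k * fp.u) :=
  one_add_pow_sub_one_le_two_mul fp.u_pos.le k h

theorem fl_zero : fp.fl 0 = 0 := by
  have := fp.abs_fl_sub_le 0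
  simpa using this

theorem abs_fl_le (x : ℝ) : |fp.fl x| ≤ (1 + fp.u) * |x| := by
  have h1 := fp.abs_fl_sub_le x
  have h2 := abs_sub_abs_le_abs_sub (fp.fl x) x
  linarith

/-- The error of rounding an approximation `y` of `x`. -/
theorem abs_fl_sub_le_of_abs_sub_le {x y z : ℝ} {k : ℕ} (hz : |x| ≤ z)
    (h : |y - x| ≤ fp.nu k * z) : |fp.fl y - x| ≤ fp.nu (k + 1) * z := by
  have h1 := fp.abs_fl_sub_le y
  have h2 : |y| ≤ z + fp.nu k * z := by
    have := abs_sub_abs_le_abs_sub y x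
    linarith
  have h3 : |fp.fl y - x| ≤ |fp.fl y - y| + |y - x| := abs_sub_le _ _ _
  rw [nu_succ]
  nlinarith [fp.u_pos]

/-- The rounding error relative to the rounded value. -/
theorem abs_fl_sub_le_gamma_one (hu : fp.u < 1) (x : ℝ) :
    |fp.fl x - x| ≤ fp.gamma 1 * |fp.fl x| := by
  have h1 := fp.abs_fl_sub_le x
  have h2 := abs_sub_abs_le_abs_sub x (fp.fl x)
  rw [abs_sub_comm] at h2
  simp only [gamma, Nat.cast_one, one_mul]
  rw [div_mul_eq_mul_div, le_div_iff₀ (by linarith)]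
  have := fp.u_pos
  nlinarith [abs_nonneg (fp.fl x - x)]

theorem gamma_pos {k : ℕ} (hk : 0 < k) (h : k * fp.u < 1) : 0 < fp.gamma k :=
  div_pos (mul_pos (by exact_mod_cast hk) fp.u_pos) (by linarith)

end FloatArith

theorem IsFlSum.card_pos {fp : FloatArith} {t : Multiset ℝ} {r : ℝ} (h : IsFlSum fp t r) :
    1 ≤ t.card := by
  induction h with
  | single => simp
  | add _ _ h1 h2 => rw [Multiset.card_add]; omega

/-- In a bracketing of `N` terms each term passes through at most `N - 1` additions. In the
induction both parts are nonempty, so each has at least one term fewer than the whole, which leaves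
room for the rounding at the root. -/
theorem IsFlSum.abs_sub_le {fp : FloatArith} {t : Multiset ℝ} {r : ℝ} (h : IsFlSum fp t r) :
    |r - t.sum| ≤ fp.nu (t.card - 1) * (t.map abs).sum := by
  induction h with
  | single x => simp [FloatArith.nu_zero]
  | @add t t' a b ht ht' iha ihb =>
    have h1 := ht.card_pos
    have h2 := ht'.card_pos
    rw [Multiset.card_add, Multiset.sum_add, Multiset.map_add, Multiset.sum_add]
    obtain ⟨k, hk⟩ : ∃ k, t.card + t'.card - 1 = k + 1 := ⟨t.card + t'.card - 2, by omega⟩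
    rw [hk]
    have p1 : (0 : ℝ) ≤ (t.map abs).sum := (abs_nonneg _).trans Multiset.abs_sum_le_sum_abs
    have p2 : (0 : ℝ) ≤ (t'.map abs).sum := (abs_nonneg _).trans Multiset.abs_sum_le_sum_abs
    refine fp.abs_fl_sub_le_of_abs_sub_le ?_ ?_
    · exact (abs_add_le _ _).trans
        (add_le_add Multiset.abs_sum_le_sum_abs Multiset.abs_sum_le_sum_abs)
    · have e : a + b - (t.sum + t'.sum) = (a - t.sum) + (b - t'.sum) := by ring
      rw [e, mul_add]
      refine (abs_add_le _ _).trans (add_le_add (iha.trans ?_) (ihb.trans ?_))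
      · exact mul_le_mul_of_nonneg_right (fp.nu_mono (by omega)) p1
      · exact mul_le_mul_of_nonneg_right (fp.nu_mono (by omega)) p2

/-- Rounding the products costs one factor `1 + u` on top of the `card - 1` of the summation. -/
theorem IsFlDot.abs_sub_le {fp : FloatArith} {ι : Type} {t : Finset ι} {x y : ι → ℝ} {r : ℝ}
    (h : IsFlDot fp t x y r) :
    |r - ∑ i ∈ t, x i * y i| ≤ fp.nu t.card * ∑ i ∈ t, |x i * y i| := by
  rcases h with ⟨rfl, rfl⟩ | h
  · simp
  have h1 := h.card_pos
  have h0 := h.abs_sub_le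
  simp only [Multiset.map_map, Multiset.card_map, Finset.card_val, Function.comp_def] at h0 h1
  obtain ⟨k, hk⟩ : ∃ k, t.card = k + 1 := ⟨t.card - 1, by omega⟩
  rw [hk, Nat.add_sub_cancel] at h0
  rw [hk]
  change |r - ∑ i ∈ t, fp.fl (x i * y i)| ≤ fp.nu k * ∑ i ∈ t, |fp.fl (x i * y i)| at h0
  have h2 : ∑ i ∈ t, |fp.fl (x i * y i)| ≤ (1 + fp.u) * ∑ i ∈ t, |x i * y i| := by
    rw [Finset.mul_sum]
    exact Finset.sum_le_sum fun i _ => fp.abs_fl_le _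
  have h3 : |∑ i ∈ t, fp.fl (x i * y i) - ∑ i ∈ t, x i * y i| ≤ fp.u * ∑ i ∈ t, |x i * y i| := by
    rw [← Finset.sum_sub_distrib, Finset.mul_sum]
    exact (Finset.abs_sum_le_sum_abs _ _).trans (Finset.sum_le_sum fun i _ => fp.abs_fl_sub_le _)
  have h4 := _root_.abs_sub_le r (∑ i ∈ t, fp.fl (x i * y i)) (∑ i ∈ t, x i * y i)
  have h5 := mul_le_mul_of_nonneg_left h2 (fp.nu_nonneg k)
  rw [FloatArith.nu_succ]
  nlinarith

theorem IsFlDot.abs_sub_le_of_card_le {fp : FloatArith} {ι : Type} {t : Finset ι} {x y : ι → ℝ}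
    {r : ℝ} (h : IsFlDot fp t x y r) {k : ℕ} (hk : t.card ≤ k) :
    |r - ∑ i ∈ t, x i * y i| ≤ fp.nu k * ∑ i ∈ t, |x i * y i| :=
  h.abs_sub_le.trans (mul_le_mul_of_nonneg_right (fp.nu_mono hk)
    (Finset.sum_nonneg fun _ _ => abs_nonneg _))

/-! ### The Frobenius norm -/

section Frobenius

variable {a b d : ℕ}

theorem frobenius_sq (M : Matrix (Fin a) (Fin b) ℝ) : ‖M‖ ^ 2 = ∑ i, ∑ j, M i j ^ 2 := by
  rw [Matrix.frobenius_norm_def, ← Real.sqrt_eq_rpow, Real.sq_sqrt]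
  · simp
  · positivity

theorem frobenius_le_of_sq_le {M : Matrix (Fin a) (Fin b) ℝ} {x : ℝ} (hx : 0 ≤ x)
    (h : ∑ i, ∑ j, M i j ^ 2 ≤ x ^ 2) : ‖M‖ ≤ x := by
  rw [← frobenius_sq] at h
  exact abs_le_of_sq_le_sq' h hx |>.2

theorem frobenius_le_of_abs_le {M N : Matrix (Fin a) (Fin b) ℝ} {c : ℝ} (hc : 0 ≤ c)
    (h : ∀ i j, |M i j| ≤ c * |N i j|) : ‖M‖ ≤ c * ‖N‖ := by
  refine frobenius_le_of_sq_le (by positivity) ?_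
  rw [mul_pow, frobenius_sq, Finset.mul_sum]
  refine Finset.sum_le_sum fun i _ => ?_
  rw [Finset.mul_sum]
  refine Finset.sum_le_sum fun j _ => ?_
  have := pow_le_pow_left₀ (abs_nonneg _) (h i j) 2
  rwa [sq_abs, mul_pow, sq_abs] at this

theorem frobenius_map_abs (M : Matrix (Fin a) (Fin b) ℝ) : ‖M.map abs‖ = ‖M‖ := by
  refine (sq_eq_sq₀ (norm_nonneg _) (norm_nonneg _)).mp ?_
  simp [frobenius_sq]

/-- The right side is an entry of `|M| |N|`; the Frobenius norm is submultiplicative and blind to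
entrywise absolute values. -/
theorem frobenius_le_of_abs_le_mul {E : Matrix (Fin a) (Fin d) ℝ} {M : Matrix (Fin a) (Fin b) ℝ}
    {N : Matrix (Fin b) (Fin d) ℝ} {c : ℝ} (hc : 0 ≤ c)
    (h : ∀ i j, |E i j| ≤ c * ∑ l, |M i l * N l j|) : ‖E‖ ≤ c * (‖M‖ * ‖N‖) := by
  refine (frobenius_le_of_abs_le (N := M.map abs * N.map abs) hc fun i j => ?_).trans ?_
  · refine (h i j).trans (mul_le_mul_of_nonneg_left (le_of_eq_of_le ?_ (le_abs_self _)) hc)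
    simp [Matrix.mul_apply, abs_mul]
  · refine mul_le_mul_of_nonneg_left ((Matrix.frobenius_norm_mul _ _).trans ?_) hc
    rw [frobenius_map_abs, frobenius_map_abs]

theorem IsFlMul.norm_sub_le {fp : FloatArith} {M : Matrix (Fin a) (Fin b) ℝ}
    {N : Matrix (Fin b) (Fin d) ℝ} {W : Matrix (Fin a) (Fin d) ℝ} (h : IsFlMul fp M N W) :
    ‖W - M * N‖ ≤ fp.nu b * (‖M‖ * ‖N‖) := by
  refine frobenius_le_of_abs_le_mul (fp.nu_nonneg b) fun i j => ?_
  rw [Matrix.sub_apply, Matrix.mul_apply]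
  exact (h i j).abs_sub_le_of_card_le (by simp)

theorem IsFlSparseMul.norm_sub_le {fp : FloatArith} {A : Matrix (Fin a) (Fin a) ℝ}
    {N W : Matrix (Fin a) (Fin b) ℝ} (h : IsFlSparseMul fp A N W) :
    ‖W - A * N‖ ≤ fp.nu (maxRowNnz A) * (‖A‖ * ‖N‖) := by
  refine frobenius_le_of_abs_le_mul (fp.nu_nonneg _) fun i j => ?_
  have hz : ∀ l ∉ rowSupport A i, A i l = 0 := fun l hl => by
    simpa [rowSupport] using hl
  have := (h i j).abs_sub_le_of_card_le (k := maxRowNnz A)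
    (Finset.le_sup (f := fun i => (rowSupport A i).card) (Finset.mem_univ i))
  rw [Finset.sum_subset (Finset.subset_univ (rowSupport A i)) fun l _ hl => by simp [hz l hl],
    Finset.sum_subset (Finset.subset_univ (rowSupport A i)) fun l _ hl => by simp [hz l hl]] at this
  rwa [Matrix.sub_apply, Matrix.mul_apply]

end Frobenius

/-! ### Accumulation of errors under orthogonal transformations -/

/-- `Φ` preserves differences and Gram matrices, as multiplication by an orthogonal matrix does. -/
structure GramPreserving {n s : ℕ}
    (Φ : Matrix (Fin n) (Fin s) ℝ → Matrix (Fin n) (Fin s) ℝ) : Prop where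
  map_sub : ∀ X Y, Φ (X - Y) = Φ X - Φ Y
  gram : ∀ X, (Φ X).transpose * Φ X = X.transpose * X

section Gram

variable {n s : ℕ}

/-- The squared Frobenius norm is the trace of the Gram matrix. -/
theorem norm_eq_of_gram_eq {a b d : ℕ} {X : Matrix (Fin a) (Fin d) ℝ}
    {Y : Matrix (Fin b) (Fin d) ℝ} (h : X.transpose * X = Y.transpose * Y) : ‖X‖ = ‖Y‖ := by
  refine (sq_eq_sq₀ (norm_nonneg _) (norm_nonneg _)).mp ?_
  have key : ∀ {e : ℕ} (Z : Matrix (Fin e) (Fin d) ℝ), ‖Z‖ ^ 2 = (Z.transpose * Z).trace := by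
    intro e Z
    rw [frobenius_sq, Finset.sum_comm]
    simp [Matrix.trace, Matrix.mul_apply, sq]
  rw [key, key, h]

theorem norm_of_gram_eq_one {Q : Matrix (Fin n) (Fin s) ℝ} (h : Q.transpose * Q = 1) :
    ‖Q‖ = Real.sqrt s := by
  have : ‖Q‖ = ‖(1 : Matrix (Fin s) (Fin s) ℝ)‖ := norm_eq_of_gram_eq (by simpa using h)
  rw [this, ← Real.sqrt_sq (norm_nonneg _), frobenius_sq]
  congr 1
  simp [Matrix.one_apply]

theorem norm_mul_of_gram_eq_one {d : ℕ} {Q : Matrix (Fin n) (Fin s) ℝ}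
    (h : Q.transpose * Q = 1) (α : Matrix (Fin s) (Fin d) ℝ) : ‖Q * α‖ = ‖α‖ := by
  refine norm_eq_of_gram_eq ?_
  rw [Matrix.transpose_mul, Matrix.mul_assoc, ← Matrix.mul_assoc Q.transpose, h, Matrix.one_mul]

theorem GramPreserving.norm_map {Φ : Matrix (Fin n) (Fin s) ℝ → Matrix (Fin n) (Fin s) ℝ}
    (h : GramPreserving Φ) (X : Matrix (Fin n) (Fin s) ℝ) : ‖Φ X‖ = ‖X‖ :=
  norm_eq_of_gram_eq (h.gram X)

theorem GramPreserving.id : GramPreserving (fun X : Matrix (Fin n) (Fin s) ℝ => X) :=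
  ⟨fun _ _ => rfl, fun _ => rfl⟩

theorem GramPreserving.comp {Φ Ψ : Matrix (Fin n) (Fin s) ℝ → Matrix (Fin n) (Fin s) ℝ}
    (h : GramPreserving Φ) (h' : GramPreserving Ψ) : GramPreserving (fun X => Φ (Ψ X)) :=
  ⟨fun X Y => by rw [h'.map_sub, h.map_sub], fun X => by rw [h.gram, h'.gram]⟩

/-- `Qhat` is within relative distance `(1 + ε) ^ r - 1` of a matrix with orthonormal columns, as is
the case after `r` transformations with relative error `ε`. -/
def NearOrthonormal (ε : ℝ) (r : ℕ) (Qhat : Matrix (Fin n) (Fin s) ℝ) : Prop :=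
  ∃ Q : Matrix (Fin n) (Fin s) ℝ, Q.transpose * Q = 1 ∧
    ‖Qhat - Q‖ ≤ ((1 + ε) ^ r - 1) * Real.sqrt s

theorem idCols_gram (hsn : s ≤ n) : (idCols hsn).transpose * idCols hsn = 1 := by
  ext i j
  simp only [Matrix.mul_apply, idCols, Matrix.transpose_apply, Matrix.of_apply, Matrix.one_apply,
    mul_ite, mul_one, mul_zero, Finset.sum_ite_eq', Finset.mem_univ, if_true]
  simp [Fin.ext_iff, eq_comm]

theorem nearOrthonormal_idCols (hsn : s ≤ n) (ε : ℝ) : NearOrthonormal ε 0 (idCols hsn) :=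
  ⟨_, idCols_gram hsn, by simp⟩

/-- If `Q` is the orthonormal companion of `X`, then `Φ Q` is that of `Y`. The old error is
transported isometrically and the new one is at most `ε‖X‖ ≤ ε(1 + ε)^r √s`; the two add up to `((1
+ ε)^(r+1) - 1)√s`. -/
theorem NearOrthonormal.step {ε : ℝ} (hε : 0 ≤ ε) {r : ℕ} {X Y : Matrix (Fin n) (Fin s) ℝ}
    (h : NearOrthonormal ε r X)
    {Φ : Matrix (Fin n) (Fin s) ℝ → Matrix (Fin n) (Fin s) ℝ} (hΦ : GramPreserving Φ)
    (hY : ‖Y - Φ X‖ ≤ ε * ‖X‖) : NearOrthonormal ε (r + 1) Y := by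
  obtain ⟨Q, hQ, hX⟩ := h
  refine ⟨Φ Q, by rw [hΦ.gram, hQ], ?_⟩
  have h1 : ‖Y - Φ Q‖ ≤ ‖Y - Φ X‖ + ‖Φ X - Φ Q‖ := norm_sub_le_norm_sub_add_norm_sub _ _ _
  rw [← hΦ.map_sub, hΦ.norm_map] at h1
  have h2 : ‖X‖ ≤ ‖X - Q‖ + ‖Q‖ := by simpa using norm_add_le (X - Q) Q
  rw [norm_of_gram_eq_one hQ] at h2
  have h3 : ε * ‖X‖ ≤ ε * ((1 + ε) ^ r * Real.sqrt s) :=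
    mul_le_mul_of_nonneg_left (by linarith) hε
  rw [pow_succ]
  linarith

theorem NearOrthonormal.exists_norm_sub_le {ε : ℝ} (hε : 0 ≤ ε) {r : ℕ}
    {Qhat : Matrix (Fin n) (Fin s) ℝ} (hs : 1 ≤ s) (h : NearOrthonormal ε r Qhat)
    (hr : r * ε * Real.sqrt s ≤ 1 / 16) :
    ∃ Q : Matrix (Fin n) (Fin s) ℝ, Q.transpose * Q = 1 ∧ ‖Qhat - Q‖ ≤ 1 / 8 := by
  obtain ⟨Q, hQ, hd⟩ := h
  refine ⟨Q, hQ, hd.trans ?_⟩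
  have h1 : 1 ≤ Real.sqrt s := Real.one_le_sqrt.mpr (by exact_mod_cast hs)
  have h0 : 0 ≤ r * ε := by positivity
  have := one_add_pow_sub_one_le_two_mul hε r (by nlinarith)
  nlinarith

end Gram

end BlockResidual

namespace BlockResidual

/-! ### Householder QR -/

section Householder

variable {n s : ℕ}

/-- Multiplication by the exact reflection `I - (2 / vᵀv) v vᵀ` (the identity if `v = 0`). -/
noncomputable def reflect (v : Fin n → ℝ) (X : Matrix (Fin n) (Fin s) ℝ) :
    Matrix (Fin n) (Fin s) ℝ :=
  Matrix.of fun i j => X i j - 2 / (∑ l, v l ^ 2) * (∑ l, v l * X l j) * v i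

theorem gramPreserving_reflect (v : Fin n → ℝ) :
    GramPreserving (reflect v : Matrix (Fin n) (Fin s) ℝ → _) := by
  constructor
  · intro X Y
    ext i j
    simp only [reflect, Matrix.of_apply, Matrix.sub_apply, mul_sub, Finset.sum_sub_distrib]
    ring
  · intro X
    ext i j
    simp only [reflect, Matrix.mul_apply, Matrix.transpose_apply, Matrix.of_apply]
    set V := ∑ l, v l ^ 2 with hV
    set a := ∑ l, v l * X l i with ha
    set b := ∑ l, v l * X l j with hb
    have e : ∀ l, (X l i - 2 / V * a * v l) * (X l j - 2 / V * b * v l) =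
        X l i * X l j - 2 / V * b * (v l * X l i) - 2 / V * a * (v l * X l j)
          + (2 / V) ^ 2 * a * b * v l ^ 2 := fun l => by ring
    simp only [e, Finset.sum_add_distrib, Finset.sum_sub_distrib, ← Finset.mul_sum]
    rw [← hV, ← ha, ← hb]
    -- For `V = 0` the convention `2 / 0 = 0` makes the map the identity.
    rcases eq_or_ne V 0 with h | h
    · simp [h]
    · field_simp
      ring

/-- From `(a + b)² ≤ 2a² + 2b²` and `2(u² + c²) ≤ 4(u + c)²`. The error of a reflection has this
shape: a relative error in `x` plus a multiple of `v`. -/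
theorem sum_sq_le_of_abs_le {x v E : Fin n → ℝ} {u K c : ℝ} (hu : 0 ≤ u) (hc : 0 ≤ c)
    (hE : ∀ i, |E i| ≤ u * |x i| + K * |v i|)
    (hKv : K ^ 2 * ∑ i, v i ^ 2 ≤ c ^ 2 * ∑ i, x i ^ 2) :
    ∑ i, E i ^ 2 ≤ (2 * (u + c)) ^ 2 * ∑ i, x i ^ 2 := by
  have h1 : ∀ i, E i ^ 2 ≤ 2 * u ^ 2 * x i ^ 2 + 2 * K ^ 2 * v i ^ 2 := fun i => by
    have h := pow_le_pow_left₀ (abs_nonneg _) (hE i) 2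
    rw [sq_abs] at h
    have h2 := sq_nonneg (u * |x i| - K * |v i|)
    have h3 := sq_abs (x i)
    have h4 := sq_abs (v i)
    rw [← h3, ← h4]
    nlinarith
  have h2 := Finset.sum_le_sum fun i (_ : i ∈ Finset.univ) => h1 i
  rw [Finset.sum_add_distrib, ← Finset.mul_sum, ← Finset.mul_sum] at h2
  have h3 : (0 : ℝ) ≤ ∑ i, x i ^ 2 := Finset.sum_nonneg fun i _ => sq_nonneg _
  nlinarith [mul_nonneg (mul_nonneg hu hc) h3, mul_nonneg (sq_nonneg u) h3,
    mul_nonneg (sq_nonneg c) h3]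

/-- The comparison is with the exact reflection for the computed `v`, so errors in `v` itself are
harmless: what matters is how far `β` is from `2 / vᵀv`. Cauchy–Schwarz bounds `∑ |v_l x_l|`, and
the factor `3` comes from `|β| vᵀv ≤ 2 + e ≤ 3`. -/
theorem IsFlReflected.sum_sq_sub_le {fp : FloatArith} {k : Fin n} {v : Fin n → ℝ} {β : ℝ}
    {x y : Fin n → ℝ} (h : IsFlReflected fp k v β x y) (hv : ∀ i, i < k → v i = 0) {e : ℝ}
    (he0 : 0 ≤ e) (he1 : e ≤ 1)
    (he : |β * ∑ l, v l ^ 2 - 2| ≤ e ∨ ∑ l, v l ^ 2 = 0) :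
    ∑ i, (y i - (x i - 2 / (∑ l, v l ^ 2) * (∑ l, v l * x l) * v i)) ^ 2 ≤
      (2 * (fp.u + (3 * fp.nu (n + 3) + e))) ^ 2 * ∑ i, x i ^ 2 := by
  obtain ⟨w, hw, hlt, hge⟩ := h
  set V := ∑ l, v l ^ 2 with hV
  set p := ∑ l, v l * x l with hp
  set S := ∑ l, |v l * x l| with hS
  have hS0 : 0 ≤ S := Finset.sum_nonneg fun _ _ => abs_nonneg _
  have hV0 : 0 ≤ V := Finset.sum_nonneg fun _ _ => sq_nonneg _
  have hX0 : 0 ≤ ∑ i, x i ^ 2 := Finset.sum_nonneg fun _ _ => sq_nonneg _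
  have hu := fp.u_pos
  have hpS : |p| ≤ S := Finset.abs_sum_le_sum_abs _ _
  have hCS : S ^ 2 ≤ V * ∑ i, x i ^ 2 := by
    have := Finset.sum_mul_sq_le_sq_mul_sq Finset.univ (fun i => |v i|) (fun i => |x i|)
    simpa only [sq_abs, ← abs_mul] using this
  have hwp : |w - p| ≤ fp.nu n * S := by
    have := hw.abs_sub_le_of_card_le (k := n) ((Finset.card_le_univ _).trans (by simp))
    have hz : ∀ l ∈ Finset.univ, l ∉ Finset.Ici k → v l * x l = 0 := fun l _ hl => by
      rw [hv l (by simpa using hl), zero_mul]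
    rw [Finset.sum_subset (Finset.subset_univ (Finset.Ici k)) hz,
      Finset.sum_subset (Finset.subset_univ (Finset.Ici k))
        fun l h1 hl => by rw [hz l h1 hl, abs_zero]] at this
    exact this
  have hb : |fp.fl (β * w) - β * p| ≤ fp.nu (n + 1) * (|β| * S) := by
    refine fp.abs_fl_sub_le_of_abs_sub_le ?_ ?_
    · rw [abs_mul]; gcongr
    · rw [← mul_sub, abs_mul]
      nlinarith [abs_nonneg β]
  have hg : ∀ i, |fp.fl (v i * fp.fl (β * w)) - v i * (β * p)| ≤
      fp.nu (n + 2) * (|v i| * (|β| * S)) := fun i => by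
    refine fp.abs_fl_sub_le_of_abs_sub_le ?_ ?_
    · rw [abs_mul, abs_mul]; gcongr
    · rw [← mul_sub, abs_mul]
      nlinarith [abs_nonneg (v i)]
  have hnu := fp.nu_nonneg (n + 3)
  have hy : ∀ i, |y i - (x i - v i * (β * p))| ≤
      fp.u * |x i| + fp.nu (n + 3) * (|v i| * (|β| * S)) := fun i => by
    rcases lt_or_ge i k with hi | hi
    · rw [hlt i hi, hv i hi]
      simp only [zero_mul, sub_zero, sub_self, abs_zero]
      positivity
    · rw [hge i hi]
      have h1 := fp.abs_fl_sub_le (x i - fp.fl (v i * fp.fl (β * w)))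
      have h2 := hg i
      have h3 : |v i * (β * p)| ≤ |v i| * (|β| * S) := by
        rw [abs_mul, abs_mul]; gcongr
      have h4 : |x i - fp.fl (v i * fp.fl (β * w))| ≤
          |x i| + (fp.nu (n + 2) * (|v i| * (|β| * S)) + |v i| * (|β| * S)) := by
        have e : x i - fp.fl (v i * fp.fl (β * w)) =
          x i - (fp.fl (v i * fp.fl (β * w)) - v i * (β * p)) - v i * (β * p) := by ring
        rw [e]
        linarith [abs_sub (x i - (fp.fl (v i * fp.fl (β * w)) - v i * (β * p))) (v i * (β * p)),
          abs_sub (x i) (fp.fl (v i * fp.fl (β * w)) - v i * (β * p))]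
      have e : fp.fl (x i - fp.fl (v i * fp.fl (β * w))) - (x i - v i * (β * p)) =
          (fp.fl (x i - fp.fl (v i * fp.fl (β * w))) - (x i - fp.fl (v i * fp.fl (β * w)))) -
            (fp.fl (v i * fp.fl (β * w)) - v i * (β * p)) := by ring
      rw [e]
      refine (abs_sub _ _).trans ?_
      rw [fp.nu_succ (n + 2)]
      nlinarith
  -- The coefficient of `|v i|` collects the rounding errors and the defect of `β` from `2 / V`.
  refine sum_sq_le_of_abs_le (v := v) (K := (fp.nu (n + 3) * |β| + |β - 2 / V|) * S)
    hu.le (by positivity) (fun i => ?_) ?_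
  · have e : y i - (x i - 2 / V * p * v i) =
        (y i - (x i - v i * (β * p))) - v i * ((β - 2 / V) * p) := by ring
    rw [e]
    have h5 : |v i * ((β - 2 / V) * p)| ≤ |v i| * (|β - 2 / V| * S) := by
      rw [abs_mul, abs_mul]; gcongr
    linarith [abs_sub (y i - (x i - v i * (β * p))) (v i * ((β - 2 / V) * p)), hy i]
  · have hc : (fp.nu (n + 3) * |β| + |β - 2 / V|) * V ≤ 3 * fp.nu (n + 3) + e := by
      rcases eq_or_ne V 0 with h0 | h0
      · rw [h0, mul_zero]; positivity
      · have he := he.resolve_right h0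
        have h1 : |β - 2 / V| * V = |β * V - 2| := by
          rw [← abs_of_nonneg hV0, ← abs_mul, abs_of_nonneg hV0]
          congr 1
          field_simp
        have h2 : |β| * V ≤ 3 := by
          rw [← abs_of_nonneg hV0, ← abs_mul]
          have := abs_le.mp he
          exact abs_le.mpr ⟨by linarith, by linarith⟩
        rw [add_mul, h1]
        nlinarith
    have h1 := pow_le_pow_left₀ (by positivity) hc 2
    calc ((fp.nu (n + 3) * |β| + |β - 2 / V|) * S) ^ 2 * V
        = (fp.nu (n + 3) * |β| + |β - 2 / V|) ^ 2 * V * S ^ 2 := by ring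
      _ ≤ (fp.nu (n + 3) * |β| + |β - 2 / V|) ^ 2 * V * (V * ∑ i, x i ^ 2) := by gcongr
      _ = ((fp.nu (n + 3) * |β| + |β - 2 / V|) * V) ^ 2 * ∑ i, x i ^ 2 := by ring
      _ ≤ _ := by gcongr

/-! ### Accuracy of the computed Householder vector and its scalar `β` -/

theorem abs_sqrt_sub_le {q r e : ℝ} (hr : 0 < r) (hq : 0 ≤ q) (h : |q - r ^ 2| ≤ e * r ^ 2) :
    |Real.sqrt q - r| ≤ e * r := by
  have h1 : q - r ^ 2 = (Real.sqrt q - r) * (Real.sqrt q + r) := by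
    nlinarith [Real.sq_sqrt hq]
  have h0 := Real.sqrt_nonneg q
  rw [h1, abs_mul, abs_of_nonneg (by linarith : 0 ≤ Real.sqrt q + r)] at h
  have : |Real.sqrt q - r| * r ≤ e * r * r := by
    nlinarith [abs_nonneg (Real.sqrt q - r)]
  exact le_of_mul_le_mul_right this hr

/-- Rounding an approximation: additive form for small errors. -/
theorem FloatArith.abs_fl_sub_le_add (fp : FloatArith) {x y z a : ℝ} {j : ℝ} (hz : |x| ≤ z)
    (hua : fp.u ≤ a) (hja : j * a ≤ 1) (h : |y - x| ≤ j * a * z) :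
    |fp.fl y - x| ≤ (j + 2) * a * z := by
  have h1 := fp.abs_fl_sub_le y
  have h2 : |y| ≤ 2 * z := by
    have := abs_sub_abs_le_abs_sub y x
    have h0 : 0 ≤ z := (abs_nonneg _).trans hz
    nlinarith
  have h3 : |fp.fl y - x| ≤ |fp.fl y - y| + |y - x| := abs_sub_le _ _ _
  have h4 : fp.u * |y| ≤ a * (2 * z) :=
    mul_le_mul hua h2 (abs_nonneg _) (fp.u_pos.le.trans hua)
  linarith

theorem FloatArith.abs_fl_sqrt_sub_le (fp : FloatArith) {t ρ a : ℝ} (hρ : 0 < ρ) (ht : 0 ≤ t)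
    (hua : fp.u ≤ a) (ha : a ≤ 1 / 1000) (h : |t - ρ ^ 2| ≤ 2 * a * ρ ^ 2) :
    |fp.fl (Real.sqrt t) - ρ| ≤ 4 * a * ρ := by
  have := fp.abs_fl_sub_le_add (abs_of_pos hρ).le hua (by linarith) (abs_sqrt_sub_le hρ ht h)
  linarith

/-- The sign choice makes `|x|` and `σ` add without cancellation, so the relative error `4a` of `σ`
survives and the rounding adds `2a`. -/
theorem abs_abs_householder_pivot_sub_le {fp : FloatArith} {x ρ σ z a : ℝ} (hρ : 0 < ρ)
    (hua : fp.u ≤ a) (ha : a ≤ 1 / 1000) (hσ : |σ - ρ| ≤ 4 * a * ρ)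
    (hz : z = if 0 ≤ x then fp.fl (x + σ) else fp.fl (x - σ)) :
    |(|z|) - (|x| + ρ)| ≤ 6 * a * (|x| + ρ) := by
  have ha0 : 0 < a := fp.u_pos.trans_le hua
  have hm : 0 < |x| + ρ := by positivity
  have h4 : |σ - ρ| ≤ 4 * a * (|x| + ρ) :=
    hσ.trans (mul_le_mul_of_nonneg_left (by linarith [abs_nonneg x]) (by positivity))
  by_cases hx : 0 ≤ x
  · rw [if_pos hx] at hz
    have e : x + σ - (|x| + ρ) = σ - ρ := by rw [abs_of_nonneg hx]; ring
    have := fp.abs_fl_sub_le_add (abs_of_pos hm).le hua (j := 4) (by linarith)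
      (y := x + σ) (by rw [e]; exact h4)
    rw [← hz] at this
    have h5 := abs_abs_sub_abs_le z (|x| + ρ)
    rw [abs_of_pos hm] at h5
    linarith
  · rw [if_neg hx] at hz
    have e : x - σ - -(|x| + ρ) = -(σ - ρ) := by rw [abs_of_neg (not_le.mp hx)]; ring
    have := fp.abs_fl_sub_le_add (x := -(|x| + ρ)) (by rw [abs_neg, abs_of_pos hm]) hua (j := 4)
      (by linarith) (y := x - σ) (by rw [e, abs_neg]; exact h4)
    rw [← hz] at this
    have h5 := abs_abs_sub_abs_le z (-(|x| + ρ))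
    rw [abs_neg, abs_of_pos hm] at h5
    linarith

/-- With `m = |x| + ρ` the difference factors as `(|z| - m)(|z| + m)`. The factors are at most `6am`
and `(13/6)m`, and `m ≤ 2ρ`, whence `6 · 13/6 · 2 = 26`. -/
theorem abs_householder_sq_sub_le {x ρ z a : ℝ} (hρ : 0 < ρ) (hxρ : |x| ≤ ρ)
    (ha0 : 0 < a) (ha : a ≤ 1 / 1000) (hz : |(|z|) - (|x| + ρ)| ≤ 6 * a * (|x| + ρ)) :
    |(ρ ^ 2 - x ^ 2 + z ^ 2) - 2 * (ρ * (|x| + ρ))| ≤ 26 * a * (ρ * (|x| + ρ)) := by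
  obtain ⟨m, hm⟩ : ∃ m, m = |x| + ρ := ⟨_, rfl⟩
  rw [← hm] at hz ⊢
  have hm1 : 0 < m := by rw [hm]; positivity
  have hm2 : m ≤ 2 * ρ := by linarith
  have e : (ρ ^ 2 - x ^ 2 + z ^ 2) - 2 * (ρ * m) = (|z| - m) * (|z| + m) := by
    rw [← sq_abs x, ← sq_abs z, show |x| = m - ρ by linarith]
    ring
  have h1 : |(|z|) + m| ≤ 13 / 6 * m := by
    have h2 := (abs_le.mp hz).2
    have h3 : 6 * a * m ≤ 1 / 6 * m := mul_le_mul_of_nonneg_right (by linarith) hm1.le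
    rw [abs_of_nonneg (by positivity)]
    linarith
  rw [e, abs_mul]
  calc |(|z|) - m| * |(|z|) + m| ≤ 6 * a * m * (13 / 6 * m) := by gcongr
    _ = 13 * a * m * m := by ring
    _ ≤ 13 * a * m * (2 * ρ) := by gcongr
    _ = _ := by ring

theorem FloatArith.abs_fl_mul_sub_mul_le (fp : FloatArith) {ρ m σ z a : ℝ} (hρ : 0 < ρ) (hm : 0 < m)
    (hua : fp.u ≤ a) (ha : a ≤ 1 / 1000) (hσ : |σ - ρ| ≤ 4 * a * ρ) (hz : |z - m| ≤ 6 * a * m) :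
    |fp.fl (σ * z) - ρ * m| ≤ 13 * a * (ρ * m) := by
  have ha0 : 0 < a := fp.u_pos.trans_le hua
  have hρm : 0 < ρ * m := mul_pos hρ hm
  have h1 : |σ * z - ρ * m| ≤ 11 * a * (ρ * m) := by
    have e : σ * z - ρ * m = (σ - ρ) * (z - m) + (σ - ρ) * m + ρ * (z - m) := by ring
    have b1 : |(σ - ρ) * (z - m)| ≤ 4 * a * ρ * (6 * a * m) := by rw [abs_mul]; gcongr
    have b2 : |(σ - ρ) * m| ≤ 4 * a * ρ * m := by rw [abs_mul, abs_of_pos hm]; gcongr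
    have b3 : |ρ * (z - m)| ≤ ρ * (6 * a * m) := by rw [abs_mul, abs_of_pos hρ]; gcongr
    have b4 := abs_add_three ((σ - ρ) * (z - m)) ((σ - ρ) * m) (ρ * (z - m))
    have b5 : 4 * a * ρ * (6 * a * m) ≤ a * (ρ * m) := by
      calc 4 * a * ρ * (6 * a * m) = a * (a * 24) * (ρ * m) := by ring
        _ ≤ a * 1 * (ρ * m) := by gcongr; linarith
        _ = _ := by ring
    rw [e]
    linarith
  have := fp.abs_fl_sub_le_add (abs_of_pos hρm).le hua (j := 11) (by linarith) h1
  linarith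

/-- Here `V` stands for `vᵀv` and `D` for the computed `σ|v_k|`, so that `V ≈ 2w` and `D ≈ w`.
Multiplied by `D`, the defect is `(βD - 1)V + (V - 2w) - 2(D - w)`, at most `(3 + 26 + 26)aw`, while
`D ≥ w / 2`. -/
theorem FloatArith.abs_fl_one_div_mul_sub_two_le (fp : FloatArith) {V D w a : ℝ} (hw : 0 < w)
    (hua : fp.u ≤ a) (ha : a ≤ 1 / 1000) (hV : |V - 2 * w| ≤ 26 * a * w)
    (hD : |D - w| ≤ 13 * a * w) : |fp.fl (1 / D) * V - 2| ≤ 200 * a := by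
  have ha0 : 0 < a := fp.u_pos.trans_le hua
  have haw : a * w ≤ 1 / 1000 * w := mul_le_mul_of_nonneg_right ha hw.le
  have haw0 : 0 < a * w := mul_pos ha0 hw
  have hDw : w / 2 ≤ D := by linarith [(abs_le.mp hD).1]
  have hD0 : 0 < D := by linarith
  obtain ⟨β, hβ⟩ : ∃ β, β = fp.fl (1 / D) := ⟨_, rfl⟩
  rw [← hβ]
  have hβD : |β * D - 1| ≤ a := by
    have h1 := fp.abs_fl_sub_le (1 / D)
    rw [← hβ, abs_of_pos (one_div_pos.mpr hD0)] at h1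
    have e : β * D - 1 = (β - 1 / D) * D := by field_simp
    rw [e, abs_mul, abs_of_pos hD0]
    calc |β - 1 / D| * D ≤ fp.u * (1 / D) * D := by gcongr
      _ = fp.u := by field_simp
      _ ≤ a := hua
  refine le_of_mul_le_mul_right (a := D) ?_ hD0
  have e : |β * V - 2| * D = |(β * D - 1) * V + (V - 2 * w) - 2 * (D - w)| := by
    rw [show (β * D - 1) * V + (V - 2 * w) - 2 * (D - w) = (β * V - 2) * D by ring, abs_mul,
      abs_of_pos hD0]
  have hVu : |V| ≤ 3 * w := by
    have := abs_le.mp hV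
    exact abs_le.mpr ⟨by linarith, by linarith⟩
  have b1 : |(β * D - 1) * V| ≤ a * (3 * w) := by rw [abs_mul]; gcongr
  have b2 := abs_sub ((β * D - 1) * V + (V - 2 * w)) (2 * (D - w))
  have b3 := abs_add_le ((β * D - 1) * V) (V - 2 * w)
  have b4 : |2 * (D - w)| = 2 * |D - w| := by rw [abs_mul]; norm_num
  have b5 : a * (w / 2) ≤ a * D := mul_le_mul_of_nonneg_left hDw ha0.le
  rw [e]
  linarith

theorem IsFlHouseholderVector.abs_mul_sub_two_le {fp : FloatArith} {k : Fin n} {x v : Fin n → ℝ}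
    {β : ℝ} (h : IsFlHouseholderVector fp k x v β) {a : ℝ} (hna : n * fp.u ≤ a)
    (ha : a ≤ 1 / 1000) :
    (∀ i, i < k → v i = 0) ∧
      (|β * ∑ l, v l ^ 2 - 2| ≤ 200 * a ∨ ∑ l, v l ^ 2 = 0) := by
  obtain ⟨t, σ, ht, hσ, ⟨-, rfl, -⟩ | ⟨hσ0, hlt, hk, hgt, rfl⟩⟩ := h
  · simp
  refine ⟨hlt, Or.inl ?_⟩
  have hu := fp.u_pos
  have hn1 : (1 : ℝ) ≤ n := by exact_mod_cast Nat.one_le_of_lt k.isLt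
  have hua : fp.u ≤ a := le_trans (by nlinarith) hna
  set T := ∑ l ∈ Finset.Ici k, x l ^ 2 with hT
  have hTn : 0 ≤ T := Finset.sum_nonneg fun _ _ => sq_nonneg _
  have htT : |t - T| ≤ 2 * a * T := by
    have h1 := ht.abs_sub_le_of_card_le (k := n) ((Finset.card_le_univ _).trans (by simp))
    simp only [abs_mul_self] at h1
    simp only [← sq, ← hT] at h1
    have h2 := fp.nu_le_two_mul (k := n) (by linarith)
    exact h1.trans (mul_le_mul_of_nonneg_right (by linarith) hTn)
  -- `Real.sqrt` vanishes on nonpositive numbers, so a nonzero `σ` forces `t > 0`.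
  have ht0 : 0 < t := by
    by_contra hneg
    rw [Real.sqrt_eq_zero_of_nonpos (not_lt.mp hneg), fp.fl_zero] at hσ
    exact hσ0 hσ
  have hT0 : 0 < T := by
    refine lt_of_le_of_ne hTn fun h0 => ?_
    rw [← h0, sub_zero, mul_zero, abs_of_pos ht0] at htT
    linarith
  obtain ⟨ρ, hρ, hρT⟩ : ∃ ρ, 0 < ρ ∧ T = ρ ^ 2 :=
    ⟨Real.sqrt T, Real.sqrt_pos.mpr hT0, (Real.sq_sqrt hT0.le).symm⟩
  have hσρ : |σ - ρ| ≤ 4 * a * ρ :=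
    hσ ▸ fp.abs_fl_sqrt_sub_le hρ ht0.le hua ha (hρT ▸ htT)
  have hsum : ∑ l, v l ^ 2 = ρ ^ 2 - x k ^ 2 + v k ^ 2 := by
    have h1 : ∑ l, v l ^ 2 = ∑ l ∈ Finset.Ici k, v l ^ 2 :=
      (Finset.sum_subset (Finset.subset_univ _) fun l _ hl => by
        rw [hlt l (by simpa using hl)]; simp).symm
    have h2 : ∑ l ∈ Finset.Ici k, (v l ^ 2 - x l ^ 2) = v k ^ 2 - x k ^ 2 :=
      Finset.sum_eq_single_of_mem k (by simp) fun l hl hne => by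
        rw [hgt l (lt_of_le_of_ne (by simpa using hl) (Ne.symm hne)), sub_self]
    rw [Finset.sum_sub_distrib, ← h1, ← hT, hρT] at h2
    linarith
  have hxρ : |x k| ≤ ρ := by
    refine abs_le_of_sq_le_sq (b := ρ) ?_ hρ.le
    rw [← hρT]
    exact Finset.single_le_sum (f := fun l => x l ^ 2) (fun _ _ => sq_nonneg _)
      (Finset.mem_Ici.mpr le_rfl)
  have hvk := abs_abs_householder_pivot_sub_le hρ hua ha hσρ hk
  have hm : 0 < |x k| + ρ := by positivity
  rw [hsum]
  exact fp.abs_fl_one_div_mul_sub_two_le (mul_pos hρ hm) hua ha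
    (abs_householder_sq_sub_le hρ hxρ (hu.trans_le hua) ha hvk)
    (fp.abs_fl_mul_sub_mul_le hρ hm hua ha hσρ hvk)

/-- The array being reduced only supplies the vectors `v`; the error is that of `s` reflections
applied to columns of the identity. With `e = 200nu` and `ν_{n+3} ≤ 8nu`, one reflection costs at
most `2(1 + 24 + 200)nu = 450nu`. -/
theorem IsFlHouseholderQR.nearOrthonormal {fp : FloatArith} {hsn : s ≤ n}
    {P Qhat : Matrix (Fin n) (Fin s) ℝ} {Rhat : Matrix (Fin s) (Fin s) ℝ}
    (h : IsFlHouseholderQR fp hsn P Qhat Rhat) (hu : n * fp.u ≤ 1 / 1000) :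
    NearOrthonormal (500 * (n * fp.u)) s Qhat := by
  obtain ⟨v, β, M, N, -, hM, hN, hR, rfl, -⟩ := h
  have key : ∀ j, j ≤ s → NearOrthonormal (500 * (n * fp.u)) j (N (s - j)) := by
    intro j
    induction j with
    | zero => intro _; rw [Nat.sub_zero, hN]; exact nearOrthonormal_idCols hsn _
    | succ j ih =>
      intro hj
      have ih := ih (by omega)
      have hε : (0 : ℝ) ≤ n * fp.u := mul_nonneg (Nat.cast_nonneg _) fp.u_pos.le
      refine ih.step (by positivity) (gramPreserving_reflect (v ⟨s - (j + 1), by omega⟩)) ?_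
      obtain ⟨hv, he⟩ := (hM ⟨s - (j + 1), by omega⟩).1.abs_mul_sub_two_le le_rfl hu
      have hidx : s - j = s - (j + 1) + 1 := by omega
      rw [hidx]
      have hn1 : (1 : ℝ) ≤ n := by exact_mod_cast (by omega : 1 ≤ n)
      have hnu : fp.nu (n + 3) ≤ 8 * (n * fp.u) := by
        have h1 : ((n + 3 : ℕ) : ℝ) * fp.u ≤ 4 * (n * fp.u) := by
          push_cast; nlinarith [fp.u_pos]
        linarith [fp.nu_le_two_mul (k := n + 3) (by linarith)]
      have hun : fp.u ≤ n * fp.u := by nlinarith [fp.u_pos]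
      refine frobenius_le_of_sq_le (by positivity) ?_
      rw [mul_pow, frobenius_sq, Finset.sum_comm,
        Finset.sum_comm (f := fun i l => N (s - (j + 1) + 1) i l ^ 2), Finset.mul_sum]
      refine Finset.sum_le_sum fun l _ => ?_
      refine ((hR ⟨s - (j + 1), by omega⟩ l).sum_sq_sub_le hv (by positivity) (by linarith)
        he).trans ?_
      refine mul_le_mul_of_nonneg_right (pow_le_pow_left₀ ?_ ?_ 2)
        (Finset.sum_nonneg fun _ _ => sq_nonneg _)
      · have := fp.u_pos
        have := fp.nu_nonneg (n + 3)
        positivity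
      · linarith
  simpa using key s le_rfl

end Householder

end BlockResidual

namespace BlockResidual

/-! ### Givens QR -/

section Givens

variable {n s : ℕ}

theorem abs_givens_quotient_sub_le {fp : FloatArith} {a r h : ℝ} (hr : 0 < r) (ha : |a| ≤ r)
    (hu : fp.u ≤ 1 / 1000) (hh : |h - r| ≤ 6 * fp.u * r) :
    |fp.fl (a / h) - a / r| ≤ 14 * fp.u := by
  have hu0 := fp.u_pos
  have h1 : r / 2 ≤ h := by
    have := abs_le.mp hh
    nlinarith
  have h0 : 0 < h := by linarith
  have h2 : |a / h - a / r| ≤ 12 * fp.u * 1 := by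
    have e : a / h - a / r = a * (r - h) / (h * r) := by field_simp
    rw [e, abs_div, abs_mul, abs_of_pos (mul_pos h0 hr), div_le_iff₀ (mul_pos h0 hr), abs_sub_comm r]
    calc |a| * |h - r| ≤ r * (6 * fp.u * r) := by gcongr
      _ = 12 * fp.u * (r / 2 * r) := by ring
      _ ≤ 12 * fp.u * (h * r) := by gcongr
      _ = _ := by ring
  have h3 : |a / r| ≤ 1 := by
    rw [abs_div, abs_of_pos hr, div_le_one hr]; exact ha
  have := fp.abs_fl_sub_le_add h3 le_rfl (by linarith) h2
  linarith

/-- The computed cosine and sine are close to those of an exact rotation. -/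
theorem exists_near_givensCS (fp : FloatArith) (hu : fp.u ≤ 1 / 1000) (a b : ℝ) :
    ∃ c t : ℝ, c ^ 2 + t ^ 2 = 1 ∧ |(givensCS fp a b).1 - c| ≤ 14 * fp.u ∧
      |(givensCS fp a b).2 - t| ≤ 14 * fp.u := by
  have hu0 := fp.u_pos
  unfold givensCS
  split_ifs with hb
  · exact ⟨1, 0, by norm_num, by simpa using hu0.le, by simpa using hu0.le⟩
  · have hpos : 0 < a ^ 2 + b ^ 2 := by positivity
    set r := Real.sqrt (a ^ 2 + b ^ 2) with hrdef
    have hr : 0 < r := Real.sqrt_pos.mpr hpos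
    have hr2 : r ^ 2 = a ^ 2 + b ^ 2 := Real.sq_sqrt hpos.le
    obtain ⟨q, hq⟩ : ∃ q, q = fp.fl (fp.fl (a * a) + fp.fl (b * b)) := ⟨_, rfl⟩
    -- The rounded squares are off by `u r²` in total, as both are nonnegative; rounding the sum
    -- adds `2u r²`.
    have hqr : |q - r ^ 2| ≤ 4 * fp.u * r ^ 2 := by
      have h1 := fp.abs_fl_sub_le (a * a)
      have h2 := fp.abs_fl_sub_le (b * b)
      rw [abs_mul_self] at h1 h2
      have h3 : |fp.fl (a * a) + fp.fl (b * b) - r ^ 2| ≤ 1 * fp.u * r ^ 2 := by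
        have e : fp.fl (a * a) + fp.fl (b * b) - r ^ 2 =
          (fp.fl (a * a) - a * a) + (fp.fl (b * b) - b * b) := by rw [hr2]; ring
        rw [e]
        refine (abs_add_le _ _).trans ?_
        rw [hr2]
        linarith
      have := fp.abs_fl_sub_le_add (abs_of_pos (pow_pos hr 2)).le le_rfl (by linarith) h3
      rw [← hq] at this
      nlinarith [pow_pos hr 2]
    have hq0 : 0 ≤ q := by
      have := abs_le.mp hqr
      nlinarith [pow_pos hr 2]
    have hh : |fp.fl (Real.sqrt q) - r| ≤ 6 * fp.u * r := by
      have := fp.abs_fl_sub_le_add (abs_of_pos hr).le le_rfl (by linarith)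
        (abs_sqrt_sub_le hr hq0 hqr)
      linarith
    rw [← hq]
    refine ⟨a / r, b / r, ?_, abs_givens_quotient_sub_le hr ?_ hu hh,
      abs_givens_quotient_sub_le hr ?_ hu hh⟩
    · rw [div_pow, div_pow, ← add_div, ← hr2, div_self (pow_pos hr 2).ne']
    · exact abs_le_of_sq_le_sq (by nlinarith) hr.le
    · exact abs_le_of_sq_le_sq (by nlinarith) hr.le

/-- The exact transposed rotation in the rows `p` and `q`. -/
noncomputable def rotate (p q : Fin n) (c t : ℝ) (X : Matrix (Fin n) (Fin s) ℝ) :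
    Matrix (Fin n) (Fin s) ℝ :=
  Matrix.of fun i l =>
    if i = p then c * X p l - t * X q l else if i = q then t * X p l + c * X q l else X i l

theorem sum_eq_add_add_sum_sdiff {p q : Fin n} (hpq : p ≠ q) (f : Fin n → ℝ) :
    ∑ i, f i = f p + f q + ∑ i ∈ Finset.univ \ {p, q}, f i := by
  rw [← Finset.sum_pair hpq, add_comm, Finset.sum_sdiff (Finset.subset_univ _)]

theorem gramPreserving_rotate {p q : Fin n} (hpq : p ≠ q) {c t : ℝ} (h : c ^ 2 + t ^ 2 = 1) :
    GramPreserving (rotate p q c t : Matrix (Fin n) (Fin s) ℝ → _) := by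
  constructor
  · intro X Y
    ext i l
    simp only [rotate, Matrix.of_apply, Matrix.sub_apply]
    split_ifs <;> ring
  · intro X
    ext i j
    simp only [Matrix.mul_apply, Matrix.transpose_apply]
    rw [sum_eq_add_add_sum_sdiff hpq, sum_eq_add_add_sum_sdiff hpq]
    congr 1
    · simp only [rotate, Matrix.of_apply, if_true, if_neg hpq.symm]
      linear_combination (X p i * X p j + X q i * X q j) * h
    · refine Finset.sum_congr rfl fun l hl => ?_
      simp only [Finset.mem_sdiff, Finset.mem_univ, true_and, Finset.mem_insert,
        Finset.mem_singleton, not_or] at hl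
      simp [rotate, hl.1, hl.2]

theorem FloatArith.abs_fl_perturbed_mul_sub_le (fp : FloatArith) (hu : fp.u ≤ 1 / 1000)
    {d d' : ℝ} (hd : |d| ≤ 1) (h : |d' - d| ≤ 14 * fp.u) (z : ℝ) :
    |fp.fl (d' * z) - d * z| ≤ 16 * fp.u * |z| := by
  have h1 : |d' * z - d * z| ≤ 14 * fp.u * |z| := by
    rw [← sub_mul, abs_mul]; gcongr
  have h2 : |d * z| ≤ |z| := by
    rw [abs_mul]; exact mul_le_of_le_one_left (abs_nonneg _) hd
  have := fp.abs_fl_sub_le_add h2 le_rfl (by linarith) h1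
  linarith

theorem FloatArith.abs_fl_sub_le_of_two (fp : FloatArith) (hu : fp.u ≤ 1 / 1000) {w z z₁ z₂ : ℝ}
    (hz : |z| ≤ z₁ + z₂) (h : |w - z| ≤ 16 * fp.u * z₁ + 16 * fp.u * z₂) :
    |fp.fl w - z| ≤ 20 * fp.u * (z₁ + z₂) := by
  have := fp.abs_fl_sub_le_add hz le_rfl (j := 16) (by linarith) (by linarith)
  have := mul_nonneg fp.u_pos.le ((abs_nonneg _).trans hz)
  linarith

theorem abs_fl_combination_sub_le {fp : FloatArith} (hu : fp.u ≤ 1 / 1000) {c t c' t' x y : ℝ}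
    (hct : c ^ 2 + t ^ 2 = 1) (hc : |c' - c| ≤ 14 * fp.u) (ht : |t' - t| ≤ 14 * fp.u) :
    |fp.fl (fp.fl (c' * x) + fp.fl (t' * y)) - (c * x + t * y)| ≤ 20 * fp.u * (|x| + |y|) ∧
    |fp.fl (fp.fl (c' * x) - fp.fl (t' * y)) - (c * x - t * y)| ≤ 20 * fp.u * (|x| + |y|) := by
  have hc1 : |c| ≤ 1 := abs_le_of_sq_le_sq (by nlinarith) zero_le_one
  have ht1 : |t| ≤ 1 := abs_le_of_sq_le_sq (by nlinarith) zero_le_one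
  have h1 := fp.abs_fl_perturbed_mul_sub_le hu hc1 hc x
  have h2 := fp.abs_fl_perturbed_mul_sub_le hu ht1 ht y
  have hx : |c * x| ≤ |x| := by
    rw [abs_mul]; exact mul_le_of_le_one_left (abs_nonneg _) hc1
  have hy : |t * y| ≤ |y| := by
    rw [abs_mul]; exact mul_le_of_le_one_left (abs_nonneg _) ht1
  constructor
  · refine fp.abs_fl_sub_le_of_two hu ((abs_add_le _ _).trans (add_le_add hx hy)) ?_
    rw [add_sub_add_comm]
    exact (abs_add_le _ _).trans (add_le_add h1 h2)
  · refine fp.abs_fl_sub_le_of_two hu ((abs_sub _ _).trans (add_le_add hx hy)) ?_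
    rw [sub_sub_sub_comm]
    exact (abs_sub _ _).trans (add_le_add h1 h2)

/-- Both entries in a column err by at most `20u(|x| + |y|)`, and `2 · 20² (|x| + |y|)² ≤ 40² (x² +
y²)`. -/
theorem sum_sq_givensTransposed_sub_le {fp : FloatArith} (hu : fp.u ≤ 1 / 1000)
    {p q : Fin n} (hpq : p ≠ q) {c t : ℝ} {cs : ℝ × ℝ} (hct : c ^ 2 + t ^ 2 = 1)
    (hc : |cs.1 - c| ≤ 14 * fp.u) (ht : |cs.2 - t| ≤ 14 * fp.u) (X : Matrix (Fin n) (Fin s) ℝ) :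
    ∑ l, (givensTransposed fp p q cs X p l - rotate p q c t X p l) ^ 2 +
      ∑ l, (givensTransposed fp p q cs X q l - rotate p q c t X q l) ^ 2 ≤
    (40 * fp.u) ^ 2 * (∑ l, X p l ^ 2 + ∑ l, X q l ^ 2) := by
  rw [← Finset.sum_add_distrib, ← Finset.sum_add_distrib, Finset.mul_sum]
  refine Finset.sum_le_sum fun l _ => ?_
  simp only [givensTransposed, rotate, Matrix.of_apply, if_true, if_neg hpq.symm]
  have h1 := (abs_fl_combination_sub_le hu hct hc ht (x := X p l) (y := X q l)).2
  have h2 := (abs_fl_combination_sub_le hu (by rw [add_comm]; exact hct) ht hc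
    (x := X p l) (y := X q l)).1
  have h3 := pow_le_pow_left₀ (abs_nonneg _) h1 2
  have h4 := pow_le_pow_left₀ (abs_nonneg _) h2 2
  rw [sq_abs] at h3 h4
  have h5 : (|X p l| + |X q l|) ^ 2 ≤ 2 * (X p l ^ 2 + X q l ^ 2) := by
    rw [← sq_abs (X p l), ← sq_abs (X q l)]
    nlinarith [sq_nonneg (|X p l| - |X q l|)]
  have h6 := mul_le_mul_of_nonneg_left h5 (sq_nonneg (20 * fp.u))
  rw [mul_pow] at h3 h4
  linarith

/-- One stage of disjoint rotations acts like an orthogonal transformation with a small error. -/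
theorem exists_gramPreserving_stage {fp : FloatArith} (hu : fp.u ≤ 1 / 1000) (hsn : s ≤ n)
    (L : List (GivensStep n s)) (σ : List (GivensStep n s)) (hσ : ∀ e ∈ σ, e.p ≠ e.q)
    (hd : σ.Pairwise fun e f => e.p ≠ f.p ∧ e.p ≠ f.q ∧ e.q ≠ f.p ∧ e.q ≠ f.q)
    (M : Matrix (Fin n) (Fin s) ℝ) :
    ∃ (Φ : Matrix (Fin n) (Fin s) ℝ → Matrix (Fin n) (Fin s) ℝ) (T : Finset (Fin n)),
      GramPreserving Φ ∧ (∀ i ∈ T, ∃ e ∈ σ, i = e.p ∨ i = e.q) ∧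
      (∀ i ∉ T, ∀ l, givensQ fp hsn (σ ++ L) M i l =
          givensQ fp hsn L (givensReduce fp σ M) i l ∧
        Φ (givensQ fp hsn L (givensReduce fp σ M)) i l =
          givensQ fp hsn L (givensReduce fp σ M) i l) ∧
      ∑ i, ∑ l, (givensQ fp hsn (σ ++ L) M i l -
          Φ (givensQ fp hsn L (givensReduce fp σ M)) i l) ^ 2 ≤
        (40 * fp.u) ^ 2 * ∑ i ∈ T, ∑ l, givensQ fp hsn L (givensReduce fp σ M) i l ^ 2 := by
  -- `T` is the set of rows touched by the stage. Disjointness means that every row enters the error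
  -- sum at most once, so a whole stage costs no more than a single rotation.
  induction σ generalizing M with
  | nil =>
    exact ⟨_, ∅, GramPreserving.id, by simp, fun i _ l => ⟨rfl, rfl⟩, by simp [givensReduce]⟩
  | cons e σ ih =>
    rw [List.pairwise_cons] at hd
    obtain ⟨Φ, T, hΦ, hT, hfix, hsum⟩ := ih (fun f hf => hσ f (List.mem_cons_of_mem _ hf)) hd.2
      (givensForward fp e M)
    have hpq := hσ e List.mem_cons_self
    have hpT : e.p ∉ T := fun h => by
      obtain ⟨f, hf, h⟩ := hT _ h
      have := hd.1 f hf
      tauto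
    have hqT : e.q ∉ T := fun h => by
      obtain ⟨f, hf, h⟩ := hT _ h
      have := hd.1 f hf
      tauto
    obtain ⟨c, t, hct, hc, ht⟩ := exists_near_givensCS fp hu (M e.p e.j) (M e.q e.j)
    have hstep := sum_sq_givensTransposed_sub_le hu hpq hct hc ht
      (givensQ fp hsn (σ ++ L) (givensForward fp e M))
    have hY : givensQ fp hsn (e :: σ ++ L) M = givensTransposed fp e.p e.q
      (givensCS fp (M e.p e.j) (M e.q e.j)) (givensQ fp hsn (σ ++ L) (givensForward fp e M)) := rfl
    have hX : givensReduce fp (e :: σ) M = givensReduce fp σ (givensForward fp e M) := rfl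
    rw [hY, hX]
    set X := givensQ fp hsn L (givensReduce fp σ (givensForward fp e M))
    set Y := givensQ fp hsn (σ ++ L) (givensForward fp e M)
    set Z := givensTransposed fp e.p e.q (givensCS fp (M e.p e.j) (M e.q e.j)) Y with hZ
    have hYp : ∀ l, Y e.p l = X e.p l := fun l => (hfix _ hpT l).1
    have hYq : ∀ l, Y e.q l = X e.q l := fun l => (hfix _ hqT l).1
    have hΦp : ∀ l, Φ X e.p l = X e.p l := fun l => (hfix _ hpT l).2
    have hΦq : ∀ l, Φ X e.q l = X e.q l := fun l => (hfix _ hqT l).2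
    -- Rows `p` and `q` are untouched by the rest of the stage, so there the computed `Y` and the
    -- exact `Φ X` both agree with `X`, and the rotation adds no error to an older one.
    have hrp : ∀ l, rotate e.p e.q c t Y e.p l = rotate e.p e.q c t (Φ X) e.p l := fun l => by
      simp [rotate, hYp, hYq, hΦp, hΦq]
    have hrq : ∀ l, rotate e.p e.q c t Y e.q l = rotate e.p e.q c t (Φ X) e.q l := fun l => by
      simp [rotate, hYp, hYq, hΦp, hΦq]
    have hZo : ∀ i, i ≠ e.p → i ≠ e.q → ∀ l, Z i l = Y i l := fun i h1 h2 l => by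
      simp [hZ, givensTransposed, h1, h2]
    have hro : ∀ i, i ≠ e.p → i ≠ e.q → ∀ l, rotate e.p e.q c t (Φ X) i l = Φ X i l :=
      fun i h1 h2 l => by simp [rotate, h1, h2]
    refine ⟨_, insert e.p (insert e.q T), (gramPreserving_rotate hpq hct).comp hΦ, ?_, ?_, ?_⟩
    · intro i hi
      rcases Finset.mem_insert.mp hi with rfl | hi
      · exact ⟨e, List.mem_cons_self, Or.inl rfl⟩
      rcases Finset.mem_insert.mp hi with rfl | hi
      · exact ⟨e, List.mem_cons_self, Or.inr rfl⟩
      obtain ⟨f, hf, h⟩ := hT i hi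
      exact ⟨f, List.mem_cons_of_mem _ hf, h⟩
    · intro i hi l
      simp only [Finset.mem_insert, not_or] at hi
      rw [hZo i hi.1 hi.2.1, hro i hi.1 hi.2.1]
      exact hfix i hi.2.2 l
    · rw [Finset.sum_insert (by simp [hpq, hpT]), Finset.sum_insert hqT,
        sum_eq_add_add_sum_sdiff hpq]
      rw [sum_eq_add_add_sum_sdiff hpq] at hsum
      simp only [hrp, hrq, hYp, hYq] at hstep
      have hrest : ∑ i ∈ Finset.univ \ {e.p, e.q}, ∑ l, (Z i l - rotate e.p e.q c t (Φ X) i l) ^ 2 =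
          ∑ i ∈ Finset.univ \ {e.p, e.q}, ∑ l, (Y i l - Φ X i l) ^ 2 := by
        refine Finset.sum_congr rfl fun i hi => Finset.sum_congr rfl fun l _ => ?_
        simp only [Finset.mem_sdiff, Finset.mem_univ, true_and, Finset.mem_insert,
          Finset.mem_singleton, not_or] at hi
        rw [hZo i hi.1 hi.2, hro i hi.1 hi.2]
      rw [hrest]
      have n1 : 0 ≤ ∑ l, (Y e.p l - Φ X e.p l) ^ 2 := Finset.sum_nonneg fun _ _ => sq_nonneg _
      have n2 : 0 ≤ ∑ l, (Y e.q l - Φ X e.q l) ^ 2 := Finset.sum_nonneg fun _ _ => sq_nonneg _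
      linarith

theorem nearOrthonormal_givensQ {fp : FloatArith} (hu : fp.u ≤ 1 / 1000) (hsn : s ≤ n)
    (L : List (List (GivensStep n s))) (hL : ∀ σ ∈ L, ∀ e ∈ σ, e.p ≠ e.q)
    (hd : ∀ σ ∈ L, σ.Pairwise fun e f =>
      e.p ≠ f.p ∧ e.p ≠ f.q ∧ e.q ≠ f.p ∧ e.q ≠ f.q)
    (M : Matrix (Fin n) (Fin s) ℝ) :
    NearOrthonormal (40 * fp.u) L.length (givensQ fp hsn L.flatten M) := by
  have hu0 := fp.u_pos
  induction L generalizing M with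
  | nil => exact nearOrthonormal_idCols hsn _
  | cons σ L ih =>
    obtain ⟨Φ, T, hΦ, -, -, hsum⟩ := exists_gramPreserving_stage hu hsn L.flatten σ
      (hL σ List.mem_cons_self) (hd σ List.mem_cons_self) M
    refine (ih (fun τ hτ => hL τ (List.mem_cons_of_mem _ hτ))
      (fun τ hτ => hd τ (List.mem_cons_of_mem _ hτ)) (givensReduce fp σ M)).step
      (by positivity) hΦ (frobenius_le_of_sq_le (by positivity) ?_)
    rw [List.flatten_cons, mul_pow, frobenius_sq]
    refine hsum.trans (mul_le_mul_of_nonneg_left ?_ (sq_nonneg _))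
    exact Finset.sum_le_sum_of_subset_of_nonneg (Finset.subset_univ _)
      fun _ _ _ => Finset.sum_nonneg fun _ _ => sq_nonneg _

theorem IsFlGivensQR.exists_nearOrthonormal {fp : FloatArith} (hu : fp.u ≤ 1 / 1000) {hsn : s ≤ n}
    {P Qhat : Matrix (Fin n) (Fin s) ℝ} {Rhat : Matrix (Fin s) (Fin s) ℝ}
    (h : IsFlGivensQR fp hsn P Qhat Rhat) :
    ∃ r, r + 2 ≤ n + s ∧ NearOrthonormal (40 * fp.u) r Qhat := by
  obtain ⟨L, hL, rfl, -⟩ := h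
  refine ⟨L.length, hL.length_le, nearOrthonormal_givensQ hu hsn L (fun σ hσ e he => ?_)
    hL.disjoint P⟩
  obtain ⟨pre, post, h⟩ := List.append_of_mem (List.mem_flatten.mpr ⟨σ, hσ, he⟩)
  exact (hL.valid pre e post h).1

end Givens

/-! ### Both methods -/

/-- The smallness condition makes `rε√s` at most `1/16`: it is at most `40(n + s - 2)√s u` for
Givens and `500 n s √s u` for Householder, and the size factor dominates both products of
dimensions. -/
theorem IsFlQR.exists_norm_sub_le {fp : FloatArith} {method : QRMethod} {n s : ℕ} {hsn : s ≤ n}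
    (hs : 1 ≤ s) {P Qhat : Matrix (Fin n) (Fin s) ℝ} {Rhat : Matrix (Fin s) (Fin s) ℝ}
    (h : IsFlQR fp method hsn P Qhat Rhat)
    (hc : 20000 * (sizeFactor method n s * fp.u) < 1) :
    ∃ Q : Matrix (Fin n) (Fin s) ℝ, Q.transpose * Q = 1 ∧ ‖Qhat - Q‖ ≤ 1 / 8 := by
  have hu0 := fp.u_pos
  have hs1 : (1 : ℝ) ≤ s := by exact_mod_cast hs
  have hn1 : (s : ℝ) ≤ n := by exact_mod_cast hsn
  have hr1 : 1 ≤ Real.sqrt s := Real.one_le_sqrt.mpr hs1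
  cases method with
  | givens =>
    simp only [sizeFactor] at hc
    have hb : (n + s - 2) * Real.sqrt s + 1 ≤
        ((n : ℝ) + 2 * ((s : ℝ) - 1)) * (Real.sqrt s + 1) + 1 := by nlinarith
    have hb' := mul_le_mul_of_nonneg_right hb hu0.le
    have hpos : 0 ≤ (n + s - 2) * Real.sqrt s := mul_nonneg (by linarith) (by linarith)
    have hpu := mul_nonneg hpos hu0.le
    obtain ⟨r, hr, hQ⟩ := IsFlGivensQR.exists_nearOrthonormal (by linarith) h
    refine hQ.exists_norm_sub_le (by positivity) hs ?_
    have hr' : (r : ℝ) ≤ n + s - 2 := by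
      have : ((r + 2 : ℕ) : ℝ) ≤ ((n + s : ℕ) : ℝ) := by exact_mod_cast hr
      push_cast at this; linarith
    have : r * (40 * fp.u) * Real.sqrt s ≤ (n + s - 2) * (40 * fp.u) * Real.sqrt s := by gcongr
    linarith
  | householder =>
    simp only [sizeFactor] at hc
    have hb : n * s * Real.sqrt s ≤ ((n : ℝ) + 1) * (Real.sqrt s + 1) * s + 1 := by nlinarith
    have hns : (n : ℝ) ≤ n * s * Real.sqrt s := by
      have : (1 : ℝ) ≤ s * Real.sqrt s := by nlinarith
      nlinarith
    have hb' := mul_le_mul_of_nonneg_right hb hu0.le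
    have hns' := mul_le_mul_of_nonneg_right hns hu0.le
    have hQ := IsFlHouseholderQR.nearOrthonormal h (by linarith)
    refine hQ.exists_norm_sub_le (by positivity) hs ?_
    linarith

end BlockResidual

namespace BlockResidual

/-! ### The residual gap -/

section Gap

variable {n s : ℕ}

theorem one_le_sizeFactor (method : QRMethod) (n : ℕ) (hs : 1 ≤ s) :
    1 ≤ sizeFactor method n s := by
  have hs1 : (1 : ℝ) ≤ s := by exact_mod_cast hs
  have hr0 := Real.sqrt_nonneg (s : ℝ)
  cases method <;> simp only [sizeFactor, le_add_iff_nonneg_left]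
  · have : 0 ≤ (n : ℝ) + 2 * ((s : ℝ) - 1) := by
      have : (0 : ℝ) ≤ n := Nat.cast_nonneg n
      linarith
    positivity
  · positivity

/-- Needed to keep the rounding error of the product `Q̂α`, of order `s u ‖Q̂‖ ‖α‖`, small against
`‖α‖`. -/
theorem mul_sqrt_le_sizeFactor (method : QRMethod) (hs : 1 ≤ s) (hsn : s ≤ n) :
    s * Real.sqrt s ≤ sizeFactor method n s := by
  have hs1 : (1 : ℝ) ≤ s := by exact_mod_cast hs
  have hn1 : (s : ℝ) ≤ n := by exact_mod_cast hsn
  have hr0 := Real.sqrt_nonneg (s : ℝ)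
  cases method <;> simp only [sizeFactor]
  · nlinarith
  · have h1 : (s : ℝ) * Real.sqrt s ≤ (n + 1) * (Real.sqrt s + 1) := by nlinarith
    have h2 : ((n : ℝ) + 1) * (Real.sqrt s + 1) ≤ (n + 1) * (Real.sqrt s + 1) * s :=
      le_mul_of_one_le_right (by positivity) hs1
    linarith

theorem norm_flAdd_sub_le {fp : FloatArith} (hu : fp.u < 1) (M N : Matrix (Fin n) (Fin s) ℝ) :
    ‖flAdd fp M N - (M + N)‖ ≤ fp.gamma 1 * ‖flAdd fp M N‖ :=
  frobenius_le_of_abs_le (fp.gamma_pos one_pos (by simpa using hu)).le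
    fun _ _ => fp.abs_fl_sub_le_gamma_one hu _

theorem norm_flSub_sub_le {fp : FloatArith} (hu : fp.u < 1) (M N : Matrix (Fin n) (Fin s) ℝ) :
    ‖flSub fp M N - (M - N)‖ ≤ fp.gamma 1 * ‖flSub fp M N‖ :=
  frobenius_le_of_abs_le (fp.gamma_pos one_pos (by simpa using hu)).le
    fun _ _ => fp.abs_fl_sub_le_gamma_one hu _

/-- Multiplication by a nearly orthonormal matrix does not shrink much, even when computed. -/
theorem norm_le_of_near_orthonormal {Q Qhat T : Matrix (Fin n) (Fin s) ℝ}
    {α : Matrix (Fin s) (Fin s) ℝ} {ν : ℝ} (hQ : Q.transpose * Q = 1) (hd : ‖Qhat - Q‖ ≤ 1 / 8)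
    (hT : ‖T - Qhat * α‖ ≤ ν * (‖Qhat‖ * ‖α‖)) (hν : ν * ‖Qhat‖ ≤ 1 / 8) :
    ‖α‖ ≤ 4 / 3 * ‖T‖ := by
  have h1 : ‖Q * α‖ ≤ ‖T‖ + ‖T - Qhat * α‖ + ‖(Qhat - Q) * α‖ := by
    have e : Q * α = T - (T - Qhat * α) - (Qhat - Q) * α := by
      rw [Matrix.sub_mul]; abel
    calc ‖Q * α‖ = ‖T - (T - Qhat * α) - (Qhat - Q) * α‖ := by rw [← e]
      _ ≤ ‖T - (T - Qhat * α)‖ + ‖(Qhat - Q) * α‖ := norm_sub_le _ _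
      _ ≤ _ := add_le_add_left (norm_sub_le _ _) _
  rw [norm_mul_of_gram_eq_one hQ] at h1
  have h2 : ‖(Qhat - Q) * α‖ ≤ 1 / 8 * ‖α‖ :=
    (Matrix.frobenius_norm_mul _ _).trans (mul_le_mul_of_nonneg_right hd (norm_nonneg _))
  have h3 : ν * (‖Qhat‖ * ‖α‖) ≤ 1 / 8 * ‖α‖ := by
    rw [← mul_assoc]; exact mul_le_mul_of_nonneg_right hν (norm_nonneg _)
  linarith

/-- The reference is `A * T` with the computed `T`, since `T` is what is added to the iterate. The
errors of `Uα` and of `U` combine to `ν_s(1 + ν_m) + ν_m = ν_{m+s}`, and that of `T` adds `ν_s`;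
hence `m + 2s ≤ m + 3s` roundings. -/
theorem norm_sub_mul_le_gamma {fp : FloatArith} {A : Matrix (Fin n) (Fin n) ℝ}
    {Q U W T : Matrix (Fin n) (Fin s) ℝ} {α : Matrix (Fin s) (Fin s) ℝ}
    (hm : ((maxRowNnz A + 3 * s : ℕ) : ℝ) * fp.u < 1)
    (hT : IsFlMul fp Q α T) (hU : IsFlSparseMul fp A Q U) (hW : IsFlMul fp U α W) :
    ‖W - A * T‖ ≤ fp.gamma (maxRowNnz A + 3 * s) * (‖A‖ * ‖Q‖ * ‖α‖) := by
  set m := maxRowNnz A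
  have e : W - A * T = (W - U * α) + (U - A * Q) * α - A * (T - Q * α) := by
    rw [Matrix.sub_mul, Matrix.mul_sub, Matrix.mul_assoc]; abel
  have hU' := hU.norm_sub_le
  have h1 : ‖U‖ ≤ (1 + fp.nu m) * (‖A‖ * ‖Q‖) := by
    have h := norm_add_le (U - A * Q) (A * Q)
    rw [sub_add_cancel] at h
    linarith [Matrix.frobenius_norm_mul A Q]
  have h2 : ‖W - U * α‖ ≤ fp.nu s * ((1 + fp.nu m) * (‖A‖ * ‖Q‖) * ‖α‖) :=
    hW.norm_sub_le.trans (by gcongr; exact fp.nu_nonneg s)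
  have h3 : ‖(U - A * Q) * α‖ ≤ fp.nu m * (‖A‖ * ‖Q‖) * ‖α‖ :=
    (Matrix.frobenius_norm_mul _ _).trans (by gcongr)
  have h4 : ‖A * (T - Q * α)‖ ≤ ‖A‖ * (fp.nu s * (‖Q‖ * ‖α‖)) :=
    (Matrix.frobenius_norm_mul _ _).trans (by gcongr; exact hT.norm_sub_le)
  have h5 : fp.nu (m + s) + fp.nu s ≤ fp.gamma (m + 3 * s) :=
    ((fp.nu_add_le _ _).trans (fp.nu_mono (by omega))).trans (fp.nu_le_gamma hm)
  rw [fp.nu_add] at h5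
  have h6 := mul_le_mul_of_nonneg_right h5 (by positivity : 0 ≤ ‖A‖ * ‖Q‖ * ‖α‖)
  rw [e]
  have h7 := norm_sub_le ((W - U * α) + (U - A * Q) * α) (A * (T - Q * α))
  have h8 := norm_add_le (W - U * α) ((U - A * Q) * α)
  linarith

/-- One step of the recursions: the coefficient matrix and the growth of the residual gap. -/
theorem norm_residualGap_sub_le {fp : FloatArith} {method : QRMethod} {hsn : s ≤ n} (hs : 1 ≤ s)
    {A : Matrix (Fin n) (Fin n) ℝ} {B P Q X R U X' R' : Matrix (Fin n) (Fin s) ℝ}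
    {α Rhat : Matrix (Fin s) (Fin s) ℝ}
    (hc : 20000 * (sizeFactor method n s * fp.u) < 1)
    (hm : ((maxRowNnz A + 3 * s : ℕ) : ℝ) * fp.u < 1)
    (hqr : IsFlQR fp method hsn P Q Rhat) (hX : IsFlUpdateX fp X Q α X')
    (hU : IsFlSparseMul fp A Q U) (hR : IsFlUpdateR fp R U α R') {μ : ℝ}
    (hXμ : ‖X‖ ≤ μ) (hXμ' : ‖X'‖ ≤ μ) :
    ‖α‖ ≤ 4 * μ ∧
    ‖residualGap A B X' R' - residualGap A B X R‖ ≤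
      (9 / 2 * Real.sqrt s * fp.gamma (maxRowNnz A + 3 * s) + fp.gamma 1) * ‖A‖ * μ +
        fp.gamma 1 * ‖R'‖ := by
  have hu0 := fp.u_pos
  have hμ : 0 ≤ μ := (norm_nonneg _).trans hXμ
  have hsf := mul_le_mul_of_nonneg_right (one_le_sizeFactor method n hs) hu0.le
  have hss := mul_le_mul_of_nonneg_right (mul_sqrt_le_sizeFactor method hs hsn) hu0.le
  have hu : fp.u < 1 / 20000 := by linarith
  have hs1 : (1 : ℝ) ≤ s := by exact_mod_cast hs
  have hr1 : 1 ≤ Real.sqrt s := Real.one_le_sqrt.mpr hs1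
  have hγ1 : fp.gamma 1 ≤ 1 / 4 := by
    simp only [FloatArith.gamma, Nat.cast_one, one_mul]
    rw [div_le_iff₀ (by linarith)]
    linarith
  have hγ0 : 0 ≤ fp.gamma 1 := (fp.gamma_pos one_pos (by simpa using hu.trans (by norm_num))).le
  have hγm : 0 ≤ fp.gamma (maxRowNnz A + 3 * s) := (fp.gamma_pos (by omega) hm).le
  obtain ⟨Q₀, hQ₀, hd⟩ := hqr.exists_norm_sub_le hs hc
  obtain ⟨T, hT, rfl⟩ := hX
  obtain ⟨W, hW, rfl⟩ := hR
  have hQn : ‖Q‖ ≤ 9 / 8 * Real.sqrt s := by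
    have h := norm_add_le (Q - Q₀) Q₀
    rw [sub_add_cancel, norm_of_gram_eq_one hQ₀] at h
    linarith
  have hν : fp.nu s * ‖Q‖ ≤ 1 / 8 := by
    have hsu : (s : ℝ) * fp.u ≤ s * Real.sqrt s * fp.u :=
      mul_le_mul_of_nonneg_right (le_mul_of_one_le_right (by linarith) hr1) hu0.le
    have h1 := fp.nu_le_two_mul (k := s) (by linarith)
    calc fp.nu s * ‖Q‖ ≤ 2 * (s * fp.u) * (9 / 8 * Real.sqrt s) := by gcongr
      _ = 9 / 4 * (s * Real.sqrt s * fp.u) := by ring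
      _ ≤ 1 / 8 := by linarith
  have hXe := norm_flAdd_sub_le (hu.trans (by norm_num)) X T
  have hRe := norm_flSub_sub_le (hu.trans (by norm_num)) R W
  -- `T` is the difference of two iterates up to the rounding of the addition: `2μ + μ/4 ≤ 3μ`. The
  -- factor `4/3` then gives `‖α‖ ≤ 4μ`.
  have hTn : ‖T‖ ≤ 3 * μ := by
    have e : T = flAdd fp X T - X - (flAdd fp X T - (X + T)) := by abel
    have h1 := norm_sub_le (flAdd fp X T - X) (flAdd fp X T - (X + T))
    rw [← e] at h1
    have h2 := norm_sub_le (flAdd fp X T) X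
    have h3 : fp.gamma 1 * ‖flAdd fp X T‖ ≤ 1 / 4 * μ := by gcongr
    linarith
  have hα : ‖α‖ ≤ 4 * μ := by
    have := norm_le_of_near_orthonormal hQ₀ hd hT.norm_sub_le hν
    linarith
  refine ⟨hα, ?_⟩
  have e : residualGap A B (flAdd fp X T) (flSub fp R W) - residualGap A B X R =
      (W - A * T) - A * (flAdd fp X T - (X + T)) - (flSub fp R W - (R - W)) := by
    simp only [residualGap, Matrix.mul_sub, Matrix.mul_add]
    abel
  have h1 := norm_sub_le ((W - A * T) - A * (flAdd fp X T - (X + T))) (flSub fp R W - (R - W))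
  have h2 := norm_sub_le (W - A * T) (A * (flAdd fp X T - (X + T)))
  have h3 : ‖A * (flAdd fp X T - (X + T))‖ ≤ ‖A‖ * (fp.gamma 1 * μ) :=
    (Matrix.frobenius_norm_mul _ _).trans (mul_le_mul_of_nonneg_left
      (hXe.trans (mul_le_mul_of_nonneg_left hXμ' hγ0)) (norm_nonneg _))
  -- The constant `9/2` is `9/8 · 4`.
  have h4 : fp.gamma (maxRowNnz A + 3 * s) * (‖A‖ * ‖Q‖ * ‖α‖) ≤
      fp.gamma (maxRowNnz A + 3 * s) * (‖A‖ * (9 / 8 * Real.sqrt s) * (4 * μ)) := by gcongr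
  have h5 := norm_sub_mul_le_gamma hm hT hU hW
  rw [e]
  linarith

/-! ### Accumulation of the gap over all steps -/

theorem flSub_zero_of_mem {fp : FloatArith} {R : Matrix (Fin n) (Fin s) ℝ}
    (h : ∀ i j, R i j ∈ fp.F) : flSub fp R 0 = R := by
  ext i j
  simpa [flSub] using fp.fl_of_mem _ (h i j)

theorem IsFlMul.eq_zero {fp : FloatArith} {a b d : ℕ} {M : Matrix (Fin a) (Fin b) ℝ}
    {W : Matrix (Fin a) (Fin d) ℝ} (h : IsFlMul fp M 0 W) : W = 0 := by
  have := h.norm_sub_le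
  rw [Matrix.mul_zero, sub_zero, norm_zero, mul_zero, mul_zero] at this
  exact norm_le_zero_iff.mp this

theorem norm_le_maxNorm (Z : ℕ → Matrix (Fin n) (Fin s) ℝ) {k : ℕ} (hk : 1 ≤ k) {i : ℕ}
    (hi : i ∈ Finset.Icc 1 k) : ‖Z i‖ ≤ maxNorm Z k hk :=
  Finset.le_sup' (fun i => ‖Z i‖) hi

theorem maxNorm_nonneg (Z : ℕ → Matrix (Fin n) (Fin s) ℝ) {k : ℕ} (hk : 1 ≤ k) :
    0 ≤ maxNorm Z k hk :=
  (norm_nonneg _).trans (norm_le_maxNorm Z hk (Finset.mem_Icc.mpr ⟨le_rfl, hk⟩))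

theorem maxNorm_pos {Z : ℕ → Matrix (Fin n) (Fin s) ℝ} {k : ℕ} (hk : 1 ≤ k) {i : ℕ}
    (hi : i ∈ Finset.Icc 1 k) (h : Z i ≠ 0) : 0 < maxNorm Z k hk :=
  (norm_pos_iff.mpr h).trans_le (norm_le_maxNorm Z hk hi)

theorem IsFlRecursion.norm_residualGap_lt {fp : FloatArith} {method : QRMethod} {hsn : s ≤ n}
    (hs : 1 ≤ s) {A : Matrix (Fin n) (Fin n) ℝ} {B : Matrix (Fin n) (Fin s) ℝ} {k : ℕ}
    (hk : 1 ≤ k) (hA : IsUnit A.det) (hB : ∀ i j, B i j ∈ fp.F)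
    (hc : 20000 * (sizeFactor method n s * fp.u) < 1)
    (hm : ((maxRowNnz A + 3 * s : ℕ) : ℝ) * fp.u < 1)
    {P Qhat : ℕ → Matrix (Fin n) (Fin s) ℝ} {α : ℕ → Matrix (Fin s) (Fin s) ℝ}
    {X R : ℕ → Matrix (Fin n) (Fin s) ℝ} (h : IsFlRecursion fp method hsn A B P Qhat α X R k)
    (hne : ∃ i ∈ Finset.Icc 1 k, X i ≠ 0 ∨ R i ≠ 0) :
    ‖residualGap A B (X k) (R k)‖ <
      (8 * Real.sqrt s * fp.gamma (maxRowNnz A + 3 * s) + fp.gamma 1) * k * ‖A‖ * maxNorm X k hk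
        + k * fp.gamma 1 * maxNorm R k hk := by
  have hu0 := fp.u_pos
  have hu1 : fp.u < 1 := by
    have := mul_le_mul_of_nonneg_right (one_le_sizeFactor method n hs) hu0.le
    linarith
  have hs1 : (1 : ℝ) ≤ s := by exact_mod_cast hs
  have hr0 : 0 < Real.sqrt s := Real.sqrt_pos.mpr (by linarith)
  have hk0 : (0 : ℝ) < k := by exact_mod_cast hk
  have hγ1 : 0 < fp.gamma 1 := fp.gamma_pos one_pos (by simpa using hu1)
  have hγm : 0 < fp.gamma (maxRowNnz A + 3 * s) := fp.gamma_pos (by omega) hm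
  have hA0 : 0 < ‖A‖ := by
    refine norm_pos_iff.mpr ?_
    rintro rfl
    have : Nonempty (Fin n) := ⟨⟨0, by omega⟩⟩
    rw [Matrix.det_zero] at hA
    exact not_isUnit_zero hA
  set μ := maxNorm X k hk
  set ρ := maxNorm R k hk
  have hμ0 : 0 ≤ μ := maxNorm_nonneg X hk
  have hXμ : ∀ i ≤ k, ‖X i‖ ≤ μ := fun i hi => by
    rcases Nat.eq_zero_or_pos i with rfl | h0
    · rw [h.X_zero, norm_zero]; exact hμ0
    · exact norm_le_maxNorm X hk (Finset.mem_Icc.mpr ⟨h0, hi⟩)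
  have hstep : ∀ i < k, ‖α i‖ ≤ 4 * μ ∧
      ‖residualGap A B (X (i + 1)) (R (i + 1)) - residualGap A B (X i) (R i)‖ ≤
        (9 / 2 * Real.sqrt s * fp.gamma (maxRowNnz A + 3 * s) + fp.gamma 1) * ‖A‖ * μ +
          fp.gamma 1 * ρ := fun i hi => by
    obtain ⟨Rhat, hqr⟩ := h.qr i hi
    obtain ⟨U, hU, hR⟩ := h.R_succ i hi
    obtain ⟨h1, h2⟩ := norm_residualGap_sub_le (B := B) hs hc hm hqr (h.X_succ i hi) hU hR
      (hXμ i hi.le) (hXμ (i + 1) hi)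
    refine ⟨h1, h2.trans (add_le_add_right (mul_le_mul_of_nonneg_left ?_ hγ1.le) _)⟩
    exact norm_le_maxNorm R hk (Finset.mem_Icc.mpr ⟨by omega, hi⟩)
  have hgap0 : residualGap A B (X 0) (R 0) = 0 := by
    simp [residualGap, h.X_zero, h.R_zero]
  -- If all iterates vanish, the bound `‖α i‖ ≤ 4μ` makes every `α i` zero. The residual then stays
  -- equal to `B`, whose entries are floating point numbers, so the gap is zero, and strictness
  -- comes from `ρ > 0`.
  rcases hμ0.eq_or_lt with hμ | hμ
  · have hX0 : ∀ i ≤ k, X i = 0 := fun i hi => norm_le_zero_iff.mp ((hXμ i hi).trans hμ.symm.le)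
    have hRB : ∀ i ≤ k, R i = B := by
      intro i
      induction i with
      | zero => exact fun _ => h.R_zero
      | succ i ih =>
        intro hi
        obtain ⟨U, -, W, hW, hR⟩ := h.R_succ i hi
        have hα : α i = 0 := norm_le_zero_iff.mp (by linarith [(hstep i hi).1])
        rw [hα] at hW
        rw [hR, hW.eq_zero, ih (by omega), flSub_zero_of_mem hB]
    have hρ : 0 < ρ := by
      obtain ⟨i, hi, h1 | h1⟩ := hne
      · exact absurd (hX0 i (Finset.mem_Icc.mp hi).2) h1
      · exact maxNorm_pos hk hi h1
    rw [hX0 k le_rfl, hRB k le_rfl, ← hμ]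
    have : residualGap A B 0 B = 0 := by simp [residualGap]
    rw [this, norm_zero, mul_zero, zero_add]
    positivity
  · have hle : ∀ i ≤ k, ‖residualGap A B (X i) (R i)‖ ≤
        i * ((9 / 2 * Real.sqrt s * fp.gamma (maxRowNnz A + 3 * s) + fp.gamma 1) * ‖A‖ * μ +
          fp.gamma 1 * ρ) := by
      intro i
      induction i with
      | zero => intro _; simp [hgap0]
      | succ i ih =>
        intro hi
        have h1 := norm_add_le
          (residualGap A B (X (i + 1)) (R (i + 1)) - residualGap A B (X i) (R i))
          (residualGap A B (X i) (R i))
        rw [sub_add_cancel] at h1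
        push_cast
        linarith [ih (by omega), (hstep i hi).2]
    refine (hle k le_rfl).trans_lt ?_
    -- Strictness: `8 - 9/2` times this quantity is the slack. It is positive because `A ≠ 0`, which
    -- follows from nonsingularity.
    have : 0 < Real.sqrt s * fp.gamma (maxRowNnz A + 3 * s) * k * ‖A‖ * μ := by positivity
    linarith

/-- The smoothed pair `(Y, S)` obeys the recursion with `V` as the matrix to be factored and `η` as
the coefficient. As both are arbitrary there, neither the primary method nor the accuracy of `η`
matters. The index shift is due to Bl-CIRS using `Q_{i+1}` in step `i`. -/
theorem IsFlBlCIRS.isFlRecursion {fp : FloatArith} {method : QRMethod} {hsn : s ≤ n}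
    {A : Matrix (Fin n) (Fin n) ℝ} {B : Matrix (Fin n) (Fin s) ℝ} {D : BlCIRSData n s} {k : ℕ}
    (h : IsFlBlCIRS fp method hsn A B D k) :
    IsFlRecursion fp method hsn A B (fun i => D.V (i + 1)) (fun i => D.Q (i + 1))
      (fun i => D.η (i + 1)) D.Y D.S k where
  X_zero := h.Y_zero.trans h.X_zero
  R_zero := h.S_zero.trans h.R_zero
  qr i hi := ⟨_, h.qr i hi⟩
  X_succ := h.Y_succ
  R_succ i hi := ⟨_, h.U_succ i hi, h.S_succ i hi⟩

end Gap

end BlockResidual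

theorem theorem4p1 :
    ∃ c : ℕ, 1 < c ∧
      ∀ (fp : BlockResidual.FloatArith) (method : BlockResidual.QRMethod)
        (n s : ℕ) (_ : 1 ≤ s) (hsn : s ≤ n)
        (A : Matrix (Fin n) (Fin n) ℝ) (B : Matrix (Fin n) (Fin s) ℝ)
        (k : ℕ) (hk : 1 ≤ k),
        IsUnit A.det →
        (∀ i j, B i j ∈ fp.F) →
        (c : ℝ) * BlockResidual.sizeFactor method n s * fp.u < 1 / 2 →
        ((BlockResidual.maxRowNnz A + 3 * s : ℕ) : ℝ) * fp.u < 1 →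
        -- the block recursions
        (∀ (P Qhat : ℕ → Matrix (Fin n) (Fin s) ℝ) (α : ℕ → Matrix (Fin s) (Fin s) ℝ)
          (X R : ℕ → Matrix (Fin n) (Fin s) ℝ),
          BlockResidual.IsFlRecursion fp method hsn A B P Qhat α X R k →
          (∃ i ∈ Finset.Icc 1 k, X i ≠ 0 ∨ R i ≠ 0) →
          ‖BlockResidual.residualGap A B (X k) (R k)‖ <
            (8 * Real.sqrt s * fp.gamma (BlockResidual.maxRowNnz A + 3 * s) + fp.gamma 1)
                * k * ‖A‖ * BlockResidual.maxNorm X k hk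
              + k * fp.gamma 1 * BlockResidual.maxNorm R k hk) ∧
        -- the smoothed iterates of Bl-CIRS
        (∀ D : BlockResidual.BlCIRSData n s,
          BlockResidual.IsFlBlCIRS fp method hsn A B D k →
          (∃ i ∈ Finset.Icc 1 k, D.Y i ≠ 0 ∨ D.S i ≠ 0) →
          ‖BlockResidual.residualGap A B (D.Y k) (D.S k)‖ <
            (8 * Real.sqrt s * fp.gamma (BlockResidual.maxRowNnz A + 3 * s) + fp.gamma 1)
                * k * ‖A‖ * BlockResidual.maxNorm D.Y k hk
              + k * fp.gamma 1 * BlockResidual.maxNorm D.S k hk) := by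
  -- Doubling `c = 10000` turns the bound `1/2` into `1`, the form with `20000` used above.
  refine ⟨10000, by norm_num, fun fp method n s hs hsn A B k hk hA hB hc hm => ?_⟩
  have hc' : 20000 * (BlockResidual.sizeFactor method n s * fp.u) < 1 := by
    push_cast at hc
    linarith
  exact ⟨fun P Qhat α X R h hne => h.norm_residualGap_lt hs hk hA hB hc' hm hne,
    fun D h hne => h.isFlRecursion.norm_residualGap_lt hs hk hA hB hc' hm hne⟩
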